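/- Let $n\ge 5$, let $U\subseteq\mathbb R^n$ be a nonempty connected open set, and let all functions below be real-valued and smooth on $U$. Write $\partial_i=\partial/\partial u^i$. Let $u^i_t=v^i(u)\,u^i_x$, $i=1,\dots,n$, be strictly hyperbolic ($v^i(u)\ne v^j(u)$ for $i\neq j$, $u\in U$), and let $g=\sum_i g_{ii}(u)(du^i)^2$ be a non-degenerate diagonal metric on $U$ with Christoffel symbols $\Gamma^i_{jk}$. When $g$ has constant curvature $K$ (that is $R^l{}_{kij}=K(\delta^l_i g_{jk}-\delta^l_j g_{ik})$; flat means $K=0$), assume that the system is Hamiltonian for the operator associated with $g$, i.e. there is a density $H(u)$ with $$v^iu^i_x=\sum_j J^{ij}\partial_jH,\qquad J^{ij}=g^{ii}\Big(\delta^i_j\tfrac{d}{dx}-\sum_k\Gamma^j_{ik}u^k_x\Big)+K\,u^i_x\big(\tfrac{d}{dx}\big)^{-1}u^j_x,\qquad \big(\tfrac{d}{dx}\big)^{-1}f_x=f .$$ Let $B(u)_t=A(u)_x$ and $N(u)_t=M(u)_x$ be conservation laws of the system (i.e. $\partial_iA=v^i\partial_iB$ and $\partial_iM=v^i\partial_iN$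 for all $i$), with $A,B,M,N$ not all constant and with $BM-AN$ and $M-Nv^i$ ($i=1,\dots,n$) nowhere zero on $U$. Consider the reciprocal transformation $d\hat x=B\,dx+A\,dt$, $d\hat t=N\,dx+M\,dt$ and the reciprocal metric $$\hat g_{ii}=\Big(\frac{M-Nv^i}{BM-AN}\Big)^2g_{ii}.$$ Write $\langle\nabla f,\nabla h\rangle=\sum_m g^{mm}\,\partial_mf\,\partial_mh$ and $(\nabla f)^2=\langle\nabla f,\nabla f\rangle$. Call the transformation non-degenerate if for every $i$ the set of $u\in U$ with $(\partial_iB(u),\partial_iN(u))\ne(0,0)$ is dense in $U$. **A)** Let $g$ be flat. If $\hat g$ is flat, then one of the following alternatives holds on $U$; conversely, if the transformation is non-degenerate and one of them holds, then $\hat g$ is flat. (So for non-degenerate transformations $\hat g$ is flat if and only if one of them holds.) * A.i) there are constants $\kappa_1\neq0,\kappa_2,\kappa_3$ with $M=\kappa_1$, $N=\kappa_2$, $(\nabla B)^2=\kappa_3(\kappa_1B-\kappa_2A)$; * A.ii) there are constants $\kappa_1\neq0,\kappa_2,\kappa_3$ with $B=\kappa_1$, $A=\kappa_2$, $(\nabla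 N)^2=\kappa_3(\kappa_1M-\kappa_2N)$; * A.iii) there are constants $\kappa_1,\dots,\kappa_4$ with $$(\nabla B)^2=2\kappa_1A+2\kappa_2B,\quad(\nabla N)^2=2\kappa_3M+2\kappa_4N,\quad\langle\nabla B,\nabla N\rangle=\kappa_1M+\kappa_2N+\kappa_3A+\kappa_4B.$$ **B)** Let $g$ have constant curvature $2c$. If $\hat g$ is flat, then one of the following alternatives holds on $U$; conversely, if the transformation is non-degenerate and one of them holds, then $\hat g$ is flat. * B.i) there are constants $\kappa_1\ne0,\kappa_3$ with $M=\kappa_1$, $N=0$, $(\nabla B)^2+2cB^2=2\kappa_3B$; * B.ii) there are constants $\kappa_1,\dots,\kappa_4$ with $$(\nabla B)^2+2cB^2=2\kappa_1A+2\kappa_2B,\quad(\nabla N)^2+2cN^2=2\kappa_3M+2\kappa_4N,$$ $$\langle\nabla B,\nabla N\rangle+2cBN=\kappa_1M+\kappa_2N+\kappa_3A+\kappa_4B.$$ Moreover, if $c\ne0$ and $B=\kappa_1$, $A=\kappa_2$ are constant with $\kappa_1\ne0$ (in particular for a transformation of the variable $t$ alone, $B=1$, $A=0$), then $\hat g$ is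 not flat. -/

import Mathlib

open scoped ContDiff

noncomputable section

namespace Reciprocal

variable {n : ℕ}

/-- The partial derivative `∂f/∂uⁱ`. -/
def pd (i : Fin n) (f : (Fin n → ℝ) → ℝ) (u : Fin n → ℝ) : ℝ :=
  fderiv ℝ f u (Pi.single i 1)

/-- The components `g_{ij}` of the diagonal metric `∑ g_{ii} (duⁱ)²`; here `g i` is `g_{ii}`. -/
def metricEntry (g : Fin n → (Fin n → ℝ) → ℝ) (i j : Fin n) (u : Fin n → ℝ) : ℝ :=
  if i = j then g i u else 0

/-- The Christoffel symbol `Γ^i_{jk}` of the Levi-Civita connection of the diagonal metric `g`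
(so that `g^{im} = δ_{im} / g_{ii}`). -/
def christoffel (g : Fin n → (Fin n → ℝ) → ℝ) (i j k : Fin n) (u : Fin n → ℝ) : ℝ :=
  (1 / 2) * (g i u)⁻¹ *
    (pd j (metricEntry g i k) u + pd k (metricEntry g i j) u - pd i (metricEntry g j k) u)

/-- The Riemann tensor `R^l_{kij}`, with `R(∂_i, ∂_j) ∂_k = ∑_l R^l_{kij} ∂_l` and
`R(X, Y) = [∇_X, ∇_Y] - ∇_{[X, Y]}`. -/
def riemann (g : Fin n → (Fin n → ℝ) → ℝ) (l k i j : Fin n) (u : Fin n → ℝ) : ℝ :=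
  pd i (christoffel g l j k) u - pd j (christoffel g l i k) u +
    ∑ m, (christoffel g l i m u * christoffel g m j k u -
      christoffel g l j m u * christoffel g m i k u)

/-- The metric is flat on `U`: its Riemann tensor vanishes there. -/
def IsFlat (U : Set (Fin n → ℝ)) (g : Fin n → (Fin n → ℝ) → ℝ) : Prop :=
  ∀ u ∈ U, ∀ l k i j, riemann g l k i j u = 0

/-- The metric has constant (sectional) curvature `K` on `U`, that is
`R^l_{kij} = K (δ^l_i g_{jk} - δ^l_j g_{ik})`; in particular `R^{ik}_{ik} = K` for `i ≠ k`. -/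
def HasConstantCurvature (U : Set (Fin n → ℝ)) (g : Fin n → (Fin n → ℝ) → ℝ) (K : ℝ) : Prop :=
  ∀ u ∈ U, ∀ l k i j, riemann g l k i j u =
    K * ((if l = i then metricEntry g j k u else 0) - (if l = j then metricEntry g i k u else 0))

/-- `⟨∇f, ∇h⟩ = ∑_m g^{mm} ∂_m f ∂_m h`. -/
def gradInner (g : Fin n → (Fin n → ℝ) → ℝ) (f h : (Fin n → ℝ) → ℝ) (u : Fin n → ℝ) : ℝ :=
  ∑ m, (g m u)⁻¹ * pd m f u * pd m h u

/-- The `i`-th component at `x` of `∑_j J^{ij} ∂_j h` along a field `x ↦ w x`, where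
`J^{ij} = g^{ii} (δ^i_j d/dx - ∑_k Γ^j_{ik} u^k_x) + K u^i_x (d/dx)⁻¹ u^j_x`
is the Hamiltonian operator of a diagonal metric of constant curvature `K` (it is local if `K = 0`).
With the convention `(d/dx)⁻¹ f_x = f` one has `(d/dx)⁻¹ (∑_j u^j_x ∂_j h) = h`. -/
def hamiltonianFlow (g : Fin n → (Fin n → ℝ) → ℝ) (K : ℝ) (h : (Fin n → ℝ) → ℝ)
    (w : ℝ → Fin n → ℝ) (i : Fin n) (x : ℝ) : ℝ :=
  (g i (w x))⁻¹ * (deriv (fun y => pd i h (w y)) x -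
      ∑ j, ∑ k, christoffel g j i k (w x) * deriv (fun y => w y k) x * pd j h (w x)) +
    K * deriv (fun y => w y i) x * h (w x)

/-- The diagonal system `u^i_t = v^i(u) u^i_x` is Hamiltonian on `U`, with density `h`, for the
operator of the metric `g` of constant curvature `K`: `v^i u^i_x = ∑_j J^{ij} ∂_j h` along every
smooth field with values in `U`. -/
def IsHamiltonian (U : Set (Fin n → ℝ)) (g : Fin n → (Fin n → ℝ) → ℝ) (K : ℝ)
    (v : Fin n → (Fin n → ℝ) → ℝ) (h : (Fin n → ℝ) → ℝ) : Prop :=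
  ∀ w : ℝ → Fin n → ℝ, ContDiff ℝ ∞ w → (∀ x, w x ∈ U) →
    ∀ i x, v i (w x) * deriv (fun y => w y i) x = hamiltonianFlow g K h w i x

/-- `P(u)_t = F(u)_x` is a conservation law of `u^i_t = v^i(u) u^i_x`: since `u_x` is arbitrary,
`∑_i ∂_i P v^i u^i_x = ∑_i ∂_i F u^i_x` means `∂_i F = v^i ∂_i P`. -/
def IsConservationLaw (U : Set (Fin n → ℝ)) (v : Fin n → (Fin n → ℝ) → ℝ)
    (P F : (Fin n → ℝ) → ℝ) : Prop :=
  ∀ u ∈ U, ∀ i, pd i F u = v i u * pd i P u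

/-- The reciprocal metric `ĝ_{ii} = ((M - N v^i) / (B M - A N))² g_{ii}` of the transformation
`dx̂ = B dx + A dt`, `dt̂ = N dx + M dt`. -/
def reciprocalMetric (v g : Fin n → (Fin n → ℝ) → ℝ) (B A N M : (Fin n → ℝ) → ℝ)
    (i : Fin n) (u : Fin n → ℝ) : ℝ :=
  ((M u - N u * v i u) / (B u * M u - A u * N u)) ^ 2 * g i u

/-- No Riemann invariant is missing from both densities on a nonempty open part of `U`:
for each `i`, the set where `∂_i B` and `∂_i N` do not both vanish is dense in `U`. -/
def DependsOnAllInvariants (U : Set (Fin n → ℝ)) (B N : (Fin n → ℝ) → ℝ) : Prop :=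
  ∀ i, U ⊆ closure {u | u ∈ U ∧ (pd i B u ≠ 0 ∨ pd i N u ≠ 0)}

/-- The alternatives for a flat initial metric. -/
def FlatAlternatives (U : Set (Fin n → ℝ)) (g : Fin n → (Fin n → ℝ) → ℝ)
    (B A N M : (Fin n → ℝ) → ℝ) : Prop :=
  (∃ κ₁ κ₂ κ₃ : ℝ, κ₁ ≠ 0 ∧ ∀ u ∈ U, M u = κ₁ ∧ N u = κ₂ ∧
    gradInner g B B u = κ₃ * (κ₁ * B u - κ₂ * A u)) ∨
  (∃ κ₁ κ₂ κ₃ : ℝ, κ₁ ≠ 0 ∧ ∀ u ∈ U, B u = κ₁ ∧ A u = κ₂ ∧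
    gradInner g N N u = κ₃ * (κ₁ * M u - κ₂ * N u)) ∨
  (∃ κ₁ κ₂ κ₃ κ₄ : ℝ, ∀ u ∈ U,
    gradInner g B B u = 2 * κ₁ * A u + 2 * κ₂ * B u ∧
    gradInner g N N u = 2 * κ₃ * M u + 2 * κ₄ * N u ∧
    gradInner g B N u = κ₁ * M u + κ₂ * N u + κ₃ * A u + κ₄ * B u)

/-- The alternatives for an initial metric of constant curvature `2c`. -/
def ConstantCurvatureAlternatives (U : Set (Fin n → ℝ)) (g : Fin n → (Fin n → ℝ) → ℝ) (c : ℝ)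
    (B A N M : (Fin n → ℝ) → ℝ) : Prop :=
  (∃ κ₁ κ₃ : ℝ, κ₁ ≠ 0 ∧ ∀ u ∈ U, M u = κ₁ ∧ N u = 0 ∧
    gradInner g B B u + 2 * c * B u ^ 2 = 2 * κ₃ * B u) ∨
  (∃ κ₁ κ₂ κ₃ κ₄ : ℝ, ∀ u ∈ U,
    gradInner g B B u + 2 * c * B u ^ 2 = 2 * κ₁ * A u + 2 * κ₂ * B u ∧
    gradInner g N N u + 2 * c * N u ^ 2 = 2 * κ₃ * M u + 2 * κ₄ * N u ∧
    gradInner g B N u + 2 * c * B u * N u = κ₁ * M u + κ₂ * N u + κ₃ * A u + κ₄ * B u)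

end Reciprocal

end

/-! Write `g_{ii} = e_i h_i²` and `β_{ij} = ∂_i h_j / h_i`. Constant curvature `K` amounts to `∂_k
β_{ij} = β_{ik} β_{kj}` for distinct indices, together with the value `-K h_i h_j` of the bracket
`rotCurvature`. The Hamiltonian condition says that `∇^i ∇_k H + K H δ^i_k` is diagonal with entries
`v^i`. The Codazzi equations for this tensor (`pd_codazzi`) show that `v h` solves, as `h` does, the
linear system `∂_j ψ_i = β_{ji} ψ_j`. It follows that the densities `B`, `N` have diagonal Hessians.

Let `x = recipLame`, `y = recipLame₂`, so that `h = B x + N y` and `v h = A x + M y`. Both `x` and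
`y` solve the linear system whose coefficients are `β_{ij} - (∂_i B / h_i) x_j - (∂_i N / h_i) y_j`.
These are the rotation coefficients of `ĝ`, and their three-index equations hold automatically.
Hence `ĝ` is flat exactly when its bracket vanishes, and `rotCurvature_recipLame` brings this to the
form `X_i x_j + X_j x_i + Y_i y_j + Y_j y_i = 0` for `i ≠ j`. Strict hyperbolicity and `n ≥ 5` force
`X = l y`, `Y = -l x` (`exists_mul_of_five_le`). This yields `∇^i ∇_i B + K B = κ₁ v^i + κ₂`, the
analogue for `N`, and the three gradient relations. Codazzi then makes the `κ`'s constant.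

Conversely, differentiating the gradient relations recovers the Hessian equations wherever `∂_i B`
or `∂_i N` is nonzero, hence everywhere by density and continuity; substituted into the bracket,
they make it vanish. All alternatives are instances of `MainAlternative`, with `K = 0` or `K = 2c`.
-/

noncomputable section

namespace Reciprocal

variable {n : ℕ} {U : Set (Fin n → ℝ)} {u : Fin n → ℝ}

section Calculus

variable {f f₁ f₂ : (Fin n → ℝ) → ℝ}

/-! ### Partial derivatives of smooth functions on an open set -/

theorem differentiableAt_of_smooth (hU : IsOpen U) (hf : ContDiffOn ℝ ∞ f U) (hu : u ∈ U) :
    DifferentiableAt ℝ f u :=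
  (hf.contDiffAt (hU.mem_nhds hu)).differentiableAt (by simp)

theorem smooth_pd (hU : IsOpen U) (hf : ContDiffOn ℝ ∞ f U) (i : Fin n) :
    ContDiffOn ℝ ∞ (pd i f) U :=
  (hf.fderiv_of_isOpen hU (m := ∞) (by simp)).clm_apply contDiffOn_const

theorem pd_congr (hU : IsOpen U) (h : ∀ u ∈ U, f₁ u = f₂ u) (hu : u ∈ U) (i : Fin n) :
    pd i f₁ u = pd i f₂ u := by
  have : f₁ =ᶠ[nhds u] f₂ := Filter.eventuallyEq_of_mem (hU.mem_nhds hu) h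
  rw [pd, pd, this.fderiv_eq]

theorem pd_const (i : Fin n) (a : ℝ) : pd i (fun _ => a) u = 0 := by
  simp [pd]

theorem pd_add (hU : IsOpen U) (h₁ : ContDiffOn ℝ ∞ f₁ U) (h₂ : ContDiffOn ℝ ∞ f₂ U) (hu : u ∈ U)
    (i : Fin n) : pd i (fun x => f₁ x + f₂ x) u = pd i f₁ u + pd i f₂ u := by
  rw [pd, fderiv_fun_add (differentiableAt_of_smooth hU h₁ hu)
    (differentiableAt_of_smooth hU h₂ hu)]
  rfl

theorem pd_sub (hU : IsOpen U) (h₁ : ContDiffOn ℝ ∞ f₁ U) (h₂ : ContDiffOn ℝ ∞ f₂ U) (hu : u ∈ U)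
    (i : Fin n) : pd i (fun x => f₁ x - f₂ x) u = pd i f₁ u - pd i f₂ u := by
  rw [pd, fderiv_fun_sub (differentiableAt_of_smooth hU h₁ hu)
    (differentiableAt_of_smooth hU h₂ hu)]
  rfl

theorem pd_mul (hU : IsOpen U) (h₁ : ContDiffOn ℝ ∞ f₁ U) (h₂ : ContDiffOn ℝ ∞ f₂ U) (hu : u ∈ U)
    (i : Fin n) : pd i (fun x => f₁ x * f₂ x) u = pd i f₁ u * f₂ u + f₁ u * pd i f₂ u := by
  rw [pd, fderiv_fun_mul (differentiableAt_of_smooth hU h₁ hu)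
    (differentiableAt_of_smooth hU h₂ hu)]
  simp [pd]; ring

theorem pd_const_mul (hU : IsOpen U) (hf : ContDiffOn ℝ ∞ f U) (hu : u ∈ U) (a : ℝ) (i : Fin n) :
    pd i (fun x => a * f x) u = a * pd i f u := by
  rw [pd_mul hU contDiffOn_const hf hu, pd_const]; ring

theorem pd_div (hU : IsOpen U) (h₁ : ContDiffOn ℝ ∞ f₁ U) (h₂ : ContDiffOn ℝ ∞ f₂ U)
    (h0 : ∀ u ∈ U, f₂ u ≠ 0) (hu : u ∈ U) (i : Fin n) :
    pd i (fun x => f₁ x / f₂ x) u = (pd i f₁ u * f₂ u - f₁ u * pd i f₂ u) / f₂ u ^ 2 := by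
  have h := pd_mul (f₁ := fun x => f₁ x / f₂ x) hU (h₁.div h₂ h0) h₂ hu i
  rw [pd_congr hU (f₂ := f₁) (fun x hx => by simp [div_mul_cancel₀ _ (h0 x hx)]) hu] at h
  have := h0 u hu
  rw [h]
  field_simp
  ring

theorem pd_sum (hU : IsOpen U) {ι : Type*} (s : Finset ι) {F : ι → (Fin n → ℝ) → ℝ}
    (hF : ∀ m ∈ s, ContDiffOn ℝ ∞ (F m) U) (hu : u ∈ U) (i : Fin n) :
    pd i (fun x => ∑ m ∈ s, F m x) u = ∑ m ∈ s, pd i (F m) u := by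
  rw [pd, fderiv_fun_sum fun m hm => differentiableAt_of_smooth hU (hF m hm) hu]
  simp [pd]

theorem pd_comm (hU : IsOpen U) (hf : ContDiffOn ℝ ∞ f U) (hu : u ∈ U) (i j : Fin n) :
    pd i (pd j f) u = pd j (pd i f) u := by
  have hs : IsSymmSndFDerivAt ℝ f u :=
    (hf.contDiffAt (hU.mem_nhds hu)).isSymmSndFDerivAt
      (by
        simp only [minSmoothness_of_isRCLikeNormedField]
        exact WithTop.coe_le_coe.2 (le_top : (2 : ℕ∞) ≤ ⊤))
  have hd : DifferentiableAt ℝ (fderiv ℝ f) u :=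
    ((hf.fderiv_of_isOpen hU (m := ∞) (by simp)).contDiffAt
      (hU.mem_nhds hu)).differentiableAt (by simp)
  have key : ∀ a b : Fin n, pd a (pd b f) u =
      fderiv ℝ (fderiv ℝ f) u (Pi.single a 1) (Pi.single b 1) := fun a b => by
    change fderiv ℝ (fun x => fderiv ℝ f x (Pi.single b 1)) u (Pi.single a 1) = _
    rw [fderiv_clm_apply hd (differentiableAt_const _)]
    simp
  rw [key, key, hs.eq]

theorem eq_const_of_pd_eq_zero (hU : IsOpen U) (hc : IsConnected U) (hf : ContDiffOn ℝ ∞ f U)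
    (h : ∀ u ∈ U, ∀ i, pd i f u = 0) : ∃ a, ∀ u ∈ U, f u = a := by
  refine hU.exists_is_const_of_fderiv_eq_zero hc.isPreconnected (hf.differentiableOn (by simp))
    fun u hu => ?_
  ext w
  have := (fderiv ℝ f u : (Fin n → ℝ) →ₗ[ℝ] ℝ).pi_apply_eq_sum_univ w
  simp only [ContinuousLinearMap.coe_coe] at this
  rw [this]
  refine Finset.sum_eq_zero fun i _ => ?_
  have h2 := h u hu i
  rw [pd] at h2
  have : (fun j => if i = j then (1:ℝ) else 0) = Pi.single i 1 := by
    ext j; simp [Pi.single_apply, eq_comm]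
  rw [this, h2, smul_zero]

end Calculus

/-! ### Diagonal metrics in terms of Lamé coefficients and rotation coefficients -/

/-- The rotation coefficient `β_{ij} = ∂_i h_j / h_i` of the Lamé coefficients `h`. -/
def rot (h : Fin n → (Fin n → ℝ) → ℝ) (i j : Fin n) (u : Fin n → ℝ) : ℝ :=
  pd i (h j) u / h i u

/-- `h` are Lamé coefficients, with signs `e`, of the diagonal metric `g` on `U`. -/
structure IsLame (U : Set (Fin n → ℝ)) (g h : Fin n → (Fin n → ℝ) → ℝ) (e : Fin n → ℝ) :
    Prop where
  isOpen : IsOpen U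
  smooth : ∀ i, ContDiffOn ℝ ∞ (h i) U
  ne_zero : ∀ i, ∀ u ∈ U, h i u ≠ 0
  sign_ne_zero : ∀ i, e i ≠ 0
  eq : ∀ u ∈ U, ∀ i, g i u = e i * h i u ^ 2

/-- The bracket `∂_i β_{ij} / e_i + ∂_j β_{ji} / e_j + ∑_{m ≠ i, j} β_{mi} β_{mj} / e_m`, to which
the sectional curvature in the plane of `∂_i`, `∂_j` is proportional. -/
def rotCurvature (b : Fin n → Fin n → (Fin n → ℝ) → ℝ) (e : Fin n → ℝ) (i j : Fin n)
    (u : Fin n → ℝ) : ℝ :=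
  (e i)⁻¹ * pd i (b i j) u + (e j)⁻¹ * pd j (b j i) u +
    ∑ m ∈ (Finset.univ.erase i).erase j, (e m)⁻¹ * b m i u * b m j u

namespace IsLame

variable {g h : Fin n → (Fin n → ℝ) → ℝ} {e : Fin n → ℝ} (L : IsLame U g h e)
include L

theorem smooth_rot (i j : Fin n) : ContDiffOn ℝ ∞ (rot h i j) U :=
  (smooth_pd L.isOpen (L.smooth j) i).div (L.smooth i) (L.ne_zero i)

theorem pd_lame (hu : u ∈ U) (i j : Fin n) : pd i (h j) u = rot h i j u * h i u := by
  rw [rot, div_mul_cancel₀ _ (L.ne_zero i u hu)]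

theorem pd_metric (hu : u ∈ U) (i j : Fin n) :
    pd i (g j) u = 2 * e j * h j u * (rot h i j u * h i u) := by
  rw [pd_congr L.isOpen (f₂ := fun x => e j * (h j x * h j x))
    (fun x hx => by rw [L.eq x hx]; ring) hu,
    pd_const_mul L.isOpen ((L.smooth j).mul (L.smooth j)) hu,
    pd_mul L.isOpen (L.smooth j) (L.smooth j) hu, L.pd_lame hu]
  ring

theorem pd_metricEntry (hu : u ∈ U) (i j k : Fin n) :
    pd i (metricEntry g j k) u = if j = k then 2 * e j * h j u * (rot h i j u * h i u) else 0 := by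
  split_ifs with hjk
  · subst hjk
    rw [← L.pd_metric hu]
    exact pd_congr L.isOpen (fun x _ => by simp [metricEntry]) hu i
  · rw [pd_congr L.isOpen (f₂ := fun _ => 0) (fun x _ => by simp [metricEntry, hjk]) hu, pd_const]

theorem christoffel_eq (hu : u ∈ U) (l j k : Fin n) :
    christoffel g l j k u = (if l = j then rot h k l u * (h k u / h l u) else 0) +
      (if l = k then rot h j l u * (h j u / h l u) else 0) -
      (if j = k then e j / e l * (h j u / h l u) * rot h l j u else 0) := by
  have h1 := L.ne_zero l u hu
  have h2 := L.sign_ne_zero l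
  rw [christoffel, L.pd_metricEntry hu, L.pd_metricEntry hu, L.pd_metricEntry hu, L.eq u hu]
  rcases eq_or_ne l j with rfl | hlj
  · rcases eq_or_ne l k with rfl | hlk
    · simp only [if_true]
      field_simp
    · simp only [if_true, if_neg hlk]
      field_simp
      ring
  · rcases eq_or_ne l k with rfl | hlk
    · simp only [if_true, if_neg hlj, if_neg hlj.symm]
      field_simp
      ring
    · rcases eq_or_ne j k with rfl | hjk
      · simp only [if_true, if_neg hlj]
        field_simp
        ring
      · simp only [if_neg hlj, if_neg hlk, if_neg hjk]
        ring

theorem pd_ratio (hu : u ∈ U) (i j l : Fin n) :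
    pd i (fun x => h j x / h l x) u =
      rot h i j u * (h i u / h l u) - h j u / h l u * rot h i l u * (h i u / h l u) := by
  have h1 := L.ne_zero l u hu
  rw [pd_div L.isOpen (L.smooth j) (L.smooth l) (L.ne_zero l) hu, L.pd_lame hu, L.pd_lame hu]
  field_simp

theorem smooth_ratio (j l : Fin n) : ContDiffOn ℝ ∞ (fun x => h j x / h l x) U :=
  (L.smooth j).div (L.smooth l) (L.ne_zero l)

theorem pd_christoffel (hu : u ∈ U) (i l j k : Fin n) :
    pd i (christoffel g l j k) u =
      (if l = j then pd i (fun x => rot h k l x * (h k x / h l x)) u else 0) +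
      (if l = k then pd i (fun x => rot h j l x * (h j x / h l x)) u else 0) -
      (if j = k then e j / e l * pd i (fun x => (h j x / h l x) * rot h l j x) u else 0) := by
  have s1 : ∀ k l, ContDiffOn ℝ ∞ (fun x => rot h k l x * (h k x / h l x)) U := fun k l =>
    (L.smooth_rot k l).mul (L.smooth_ratio k l)
  have s2 : ContDiffOn ℝ ∞ (fun x => (h j x / h l x) * rot h l j x) U :=
    (L.smooth_ratio j l).mul (L.smooth_rot l j)
  have ite_smooth : ∀ (p : Prop) [Decidable p] {f : (Fin n → ℝ) → ℝ}, ContDiffOn ℝ ∞ f U →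
      ContDiffOn ℝ ∞ (fun x => if p then f x else 0) U := fun p _ f hf => by
    split_ifs
    exacts [hf, contDiffOn_const]
  have pd_ite : ∀ (p : Prop) [Decidable p] (f : (Fin n → ℝ) → ℝ),
      pd i (fun x => if p then f x else 0) u = if p then pd i f u else 0 := fun p _ f => by
    split_ifs
    exacts [rfl, pd_const i 0]
  rw [pd_congr L.isOpen (fun x hx => L.christoffel_eq hx l j k) hu,
    pd_sub L.isOpen ((ite_smooth _ (s1 k l)).add (ite_smooth _ (s1 j l))) ?_ hu,
    pd_add L.isOpen (ite_smooth _ (s1 k l)) (ite_smooth _ (s1 j l)) hu, pd_ite, pd_ite, pd_ite]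
  · simp only [mul_assoc]
    rw [pd_const_mul L.isOpen s2 hu]
  · refine ite_smooth _ ?_
    simp only [mul_assoc]
    exact contDiffOn_const.mul s2

theorem pd_rot_mul_ratio (hu : u ∈ U) (i j l a b : Fin n) :
    pd i (fun x => rot h a b x * (h j x / h l x)) u = pd i (rot h a b) u * (h j u / h l u) +
      rot h a b u *
        (rot h i j u * (h i u / h l u) - h j u / h l u * rot h i l u * (h i u / h l u)) := by
  rw [pd_mul L.isOpen (L.smooth_rot a b) (L.smooth_ratio j l) hu, L.pd_ratio hu]

/-- A Christoffel symbol of a diagonal metric with three distinct indices vanishes, so the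
contraction collapses. A genuine sum over `m` survives only for `l = i`, `j = k`; it becomes the sum
in `rotCurvature`. -/
theorem christoffel_mul_sum (hu : u ∈ U) (l k i j : Fin n) :
    ∑ m, christoffel g l i m u * christoffel g m j k u =
      (if l = i then rot h j l u * (h j u / h l u) * (rot h k j u * (h k u / h j u)) +
        rot h k l u * (h k u / h l u) * (rot h j k u * (h j u / h k u)) -
        (if j = k then
          ∑ m, rot h m l u * (h m u / h l u) * (e j / e m * (h j u / h m u) * rot h m j u)
        else 0) else 0) +
      rot h i l u * (h i u / h l u) * christoffel g l j k u -
      e i / e l * (h i u / h l u) * rot h l i u * christoffel g i j k u := by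
  have : ∀ m, christoffel g l i m u * christoffel g m j k u =
      (if l = i then rot h m l u * (h m u / h l u) * christoffel g m j k u else 0) +
      (if l = m then rot h i l u * (h i u / h l u) * christoffel g l j k u else 0) -
      (if i = m then e i / e l * (h i u / h l u) * rot h l i u * christoffel g i j k u else 0) := by
    intro m
    rw [L.christoffel_eq hu l i m, sub_mul, add_mul]
    congr 1
    · congr 1
      · rw [ite_mul, zero_mul]
      · split_ifs with hh
        · rw [← hh]
        · rw [zero_mul]
    · split_ifs with hh
      · rw [← hh]
      · rw [zero_mul]
  simp only [this, Finset.sum_sub_distrib, Finset.sum_add_distrib, Finset.sum_ite_eq,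
    Finset.mem_univ, if_true]
  congr 2
  split_ifs with hli hjk
  · simp only [L.christoffel_eq hu, mul_sub, mul_add, mul_ite, mul_zero, Finset.sum_sub_distrib,
      Finset.sum_add_distrib, Finset.sum_ite_eq', Finset.mem_univ, if_true, hjk]
  · simp only [L.christoffel_eq hu, mul_sub, mul_add, mul_ite, mul_zero, Finset.sum_sub_distrib,
      Finset.sum_add_distrib, Finset.sum_ite_eq', Finset.mem_univ, if_true, hjk, if_false,
      Finset.sum_const_zero]
  · simp

end IsLame

/-! ### Components of the Riemann tensor of a diagonal metric. -/

theorem riemann_antisymm (g : Fin n → (Fin n → ℝ) → ℝ) (l k i j : Fin n) :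
    riemann g l k j i u = -riemann g l k i j u := by
  simp only [riemann, Finset.sum_sub_distrib]
  ring

theorem sum_erase_erase {i j : Fin n} (hij : i ≠ j) (F : Fin n → ℝ) :
    ∑ m, F m = F i + F j + ∑ m ∈ (Finset.univ.erase i).erase j, F m := by
  rw [← Finset.add_sum_erase _ F (Finset.mem_univ i), ← Finset.add_sum_erase _ F
    (Finset.mem_erase.2 ⟨hij.symm, Finset.mem_univ j⟩)]
  ring

theorem sum_erase_erase' {i j : Fin n} (hij : i ≠ j) (F : Fin n → ℝ) :
    ∑ m ∈ Finset.univ.erase i, F m = F j + ∑ m ∈ (Finset.univ.erase i).erase j, F m := by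
  rw [← Finset.add_sum_erase _ F (Finset.mem_erase.2 ⟨hij.symm, Finset.mem_univ j⟩)]

namespace IsLame

variable {g h : Fin n → (Fin n → ℝ) → ℝ} {e : Fin n → ℝ} (L : IsLame U g h e)
include L

theorem pd_ratio_mul_rot (hu : u ∈ U) (i j l a b : Fin n) :
    pd i (fun x => (h j x / h l x) * rot h a b x) u = pd i (rot h a b) u * (h j u / h l u) +
      rot h a b u *
        (rot h i j u * (h i u / h l u) - h j u / h l u * rot h i l u * (h i u / h l u)) := by
  rw [← L.pd_rot_mul_ratio hu]
  simp only [mul_comm]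

theorem riemann_of_distinct (hu : u ∈ U) {i j k : Fin n} (hij : i ≠ j) (hik : i ≠ k)
    (hjk : j ≠ k) :
    riemann g i k i j u = -(h k u / h i u) * (pd j (rot h k i) u - rot h k j u * rot h j i u) := by
  have h1 := L.ne_zero i u hu
  have h2 := L.ne_zero j u hu
  have h3 := L.ne_zero k u hu
  rw [riemann, Finset.sum_sub_distrib, L.christoffel_mul_sum hu, L.christoffel_mul_sum hu]
  simp only [L.pd_christoffel hu,
    L.christoffel_eq hu, L.pd_rot_mul_ratio hu, L.pd_ratio_mul_rot hu, if_neg hij, if_neg hik,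
    if_neg hjk, if_neg hij.symm, if_true]
  field_simp
  ring

theorem riemann_plane (hu : u ∈ U) {i j : Fin n} (hij : i ≠ j) :
    riemann g i j i j u = -(e j * (h j u / h i u)) * rotCurvature (rot h) e i j u := by
  have h1 := L.ne_zero i u hu
  have h2 := L.ne_zero j u hu
  have e1 := L.sign_ne_zero i
  have e2 := L.sign_ne_zero j
  have hs : ∑ m ∈ (Finset.univ.erase i).erase j, rot h m i u * (h m u / h i u) *
      (e j / e m * (h j u / h m u) * rot h m j u) = e j * (h j u / h i u) *
      ∑ m ∈ (Finset.univ.erase i).erase j, (e m)⁻¹ * rot h m i u * rot h m j u := by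
    rw [Finset.mul_sum]
    refine Finset.sum_congr rfl fun m _ => ?_
    have := L.ne_zero m u hu
    have := L.sign_ne_zero m
    field_simp
  rw [riemann, Finset.sum_sub_distrib, L.christoffel_mul_sum hu, L.christoffel_mul_sum hu]
  simp only [L.pd_christoffel hu,
    L.christoffel_eq hu, L.pd_rot_mul_ratio hu, L.pd_ratio_mul_rot hu, if_neg hij,
    if_neg hij.symm, if_true, sum_erase_erase hij, hs, rotCurvature]
  field_simp
  ring

/-- Up to a nonzero factor this component is the one in `riemann_of_distinct`, by the symmetries of
the lowered tensor; hence the same equation `h3` suffices. -/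
theorem riemann_lower_eq_zero (hu : u ∈ U) {i j l : Fin n} (hij : i ≠ j) (hil : i ≠ l)
    (hjl : j ≠ l) (h3 : pd j (rot h l i) u = rot h l j u * rot h j i u) :
    riemann g l i i j u = 0 := by
  have h1 := L.ne_zero i u hu
  have h2 := L.ne_zero j u hu
  have h4 := L.ne_zero l u hu
  have e1 := L.sign_ne_zero i
  have e2 := L.sign_ne_zero j
  have e3 := L.sign_ne_zero l
  rw [riemann, Finset.sum_sub_distrib, L.christoffel_mul_sum hu, L.christoffel_mul_sum hu]
  simp only [L.pd_christoffel hu,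
    L.christoffel_eq hu, L.pd_rot_mul_ratio hu, L.pd_ratio_mul_rot hu, if_neg hij,
    if_neg hij.symm, if_neg hil.symm, if_neg hjl.symm, if_true, h3]
  field_simp
  ring

/-- Since `β_{jk} h_j / h_k = ∂_j log |h_k|`, this is the equality of mixed derivatives. It is what
cancels the derivative terms in `riemann_diag_eq_zero`. -/
theorem pd_rot_comm (hu : u ∈ U) (i j k : Fin n) :
    pd i (fun x => rot h j k x * (h j x / h k x)) u =
      pd j (fun x => rot h i k x * (h i x / h k x)) u := by
  have key : ∀ a, ∀ x ∈ U, rot h a k x * (h a x / h k x) = pd a (h k) x / h k x := by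
    intro a x hx
    have := L.ne_zero a x hx
    rw [L.pd_lame hx]
    field_simp
  rw [pd_congr L.isOpen (key j) hu, pd_congr L.isOpen (key i) hu,
    pd_div L.isOpen (smooth_pd L.isOpen (L.smooth k) _) (L.smooth k) (L.ne_zero k) hu,
    pd_div L.isOpen (smooth_pd L.isOpen (L.smooth k) _) (L.smooth k) (L.ne_zero k) hu,
    pd_comm L.isOpen (L.smooth k) hu]
  ring

theorem riemann_diag_eq_zero (hu : u ∈ U) {i j k : Fin n} (hij : i ≠ j) :
    riemann g k k i j u = 0 := by
  have hc := L.pd_rot_comm hu i j k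
  have hs : ∀ a, pd a (fun x => h k x / h k x * rot h k k x) u =
      pd a (fun x => rot h k k x * (h k x / h k x)) u := fun a => by simp only [mul_comm]
  have h1 := L.ne_zero i u hu
  have h2 := L.ne_zero j u hu
  have h4 := L.ne_zero k u hu
  have e1 := L.sign_ne_zero i
  have e2 := L.sign_ne_zero j
  have e3 := L.sign_ne_zero k
  by_cases hik : k = i
  · subst hik
    rw [riemann, Finset.sum_sub_distrib, L.christoffel_mul_sum hu, L.christoffel_mul_sum hu]
    simp only [L.pd_christoffel hu,
      L.christoffel_eq hu, if_neg hij, if_neg hij.symm, if_true, hc, hs]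
    field_simp
    ring
  by_cases hjk : k = j
  · subst hjk
    rw [riemann, Finset.sum_sub_distrib, L.christoffel_mul_sum hu, L.christoffel_mul_sum hu]
    simp only [L.pd_christoffel hu,
      L.christoffel_eq hu, if_neg hij, if_neg hij.symm, if_true, hc, hs]
    field_simp
    ring
  have hik' := Ne.symm hik
  have hjk' := Ne.symm hjk
  rw [riemann, Finset.sum_sub_distrib, L.christoffel_mul_sum hu, L.christoffel_mul_sum hu]
  simp only [L.pd_christoffel hu,
    L.christoffel_eq hu, if_neg hij, if_neg hij.symm, if_neg hik, if_neg hjk, if_neg hik',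
    if_neg hjk', if_true, hc]
  ring

theorem riemann_other_eq_zero (hu : u ∈ U) {i j k l : Fin n} (hij : i ≠ j) (hlk : l ≠ k)
    (hli : l ≠ i) (hlj : l ≠ j) (hki : k ≠ i) (hkj : k ≠ j) : riemann g l k i j u = 0 := by
  rw [riemann, Finset.sum_sub_distrib, L.christoffel_mul_sum hu, L.christoffel_mul_sum hu]
  simp only [L.pd_christoffel hu,
      L.christoffel_eq hu, if_neg hij, if_neg hij.symm, if_neg hlk, if_neg hli, if_neg hlj,
      if_neg hki.symm, if_neg hkj.symm]
  ring

/-- The Riemann tensor vanishes if the rotation coefficients satisfy the zero curvature system. -/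
theorem riemann_eq_zero (hu : u ∈ U)
    (h3 : ∀ i j k, i ≠ j → i ≠ k → j ≠ k → pd k (rot h i j) u = rot h i k u * rot h k j u)
    (h2 : ∀ i j, i ≠ j → rotCurvature (rot h) e i j u = 0) (l k i j : Fin n) :
    riemann g l k i j u = 0 := by
  -- Antisymmetry in the last two indices reduces every component with `l = i` or `l = j` to this
  -- one.
  have first : ∀ {a b c : Fin n}, a ≠ b → riemann g a c a b u = 0 := by
    intro a b c hab
    by_cases hca : c = a
    · subst hca
      exact L.riemann_diag_eq_zero hu hab
    by_cases hcb : c = b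
    · subst hcb
      rw [L.riemann_plane hu hab, h2 _ _ hab, mul_zero]
    · rw [L.riemann_of_distinct hu hab (Ne.symm hca) (Ne.symm hcb),
        h3 c a b hca hcb hab, sub_self, mul_zero]
  by_cases hij : i = j
  · subst hij
    have := riemann_antisymm (u := u) g l k i i
    linarith
  by_cases hli : l = i
  · subst hli
    exact first hij
  by_cases hlj : l = j
  · subst hlj
    rw [riemann_antisymm, first (Ne.symm hij), neg_zero]
  by_cases hlk : l = k
  · subst hlk
    exact L.riemann_diag_eq_zero hu hij
  by_cases hki : k = i
  · subst hki
    exact L.riemann_lower_eq_zero hu hij (Ne.symm hli) (Ne.symm hlj) (h3 l k j hli hlj hij)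
  by_cases hkj : k = j
  · subst hkj
    rw [riemann_antisymm, L.riemann_lower_eq_zero hu (Ne.symm hij) (Ne.symm hlj) (Ne.symm hli)
      (h3 l k i hlj hli (Ne.symm hij)), neg_zero]
  · exact L.riemann_other_eq_zero hu hij hlk hli hlj hki hkj

theorem rotCurvature_eq_of_hasConstantCurvature {K : ℝ} (hK : HasConstantCurvature U g K)
    (hu : u ∈ U) {i j : Fin n} (hij : i ≠ j) :
    rotCurvature (rot h) e i j u = -(K * h i u * h j u) := by
  have h1 := L.ne_zero i u hu
  have h2 := L.ne_zero j u hu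
  have e2 := L.sign_ne_zero j
  have := hK u hu i j i j
  rw [L.riemann_plane hu hij] at this
  simp only [metricEntry, if_true, if_neg hij, sub_zero, L.eq u hu] at this
  have h5 : e j * (h j u / h i u) ≠ 0 := mul_ne_zero e2 (div_ne_zero h2 h1)
  apply mul_left_cancel₀ h5
  linear_combination (exp := 1) -this + (e j * h j u ^ 2 * K) * (div_self h1)

theorem pd_rot_of_hasConstantCurvature {K : ℝ} (hK : HasConstantCurvature U g K)
    (hu : u ∈ U) {i j k : Fin n} (hij : i ≠ j) (hik : i ≠ k) (hjk : j ≠ k) :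
    pd k (rot h i j) u = rot h i k u * rot h k j u := by
  have := hK u hu j i j k
  rw [L.riemann_of_distinct hu hjk hij.symm hik.symm] at this
  simp only [metricEntry, if_true, if_neg hjk, if_neg hik.symm, sub_zero, mul_zero] at this
  have h5 : -(h i u / h j u) ≠ 0 :=
    neg_ne_zero.2 (div_ne_zero (L.ne_zero i u hu) (L.ne_zero j u hu))
  have h6 := (mul_eq_zero.1 this).resolve_left h5
  linarith

end IsLame

/-! ### Densities of conservation laws and the Hamiltonian structure -/

/-- The component `∂_i f / h_i` of the differential of `f`. -/
def frameGrad (h : Fin n → (Fin n → ℝ) → ℝ) (f : (Fin n → ℝ) → ℝ) (i : Fin n) (u : Fin n → ℝ) : ℝ :=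
  pd i f u / h i u

/-- The quantity `h_i ∇^i ∇_i f` (no summation). -/
def frameHess (h : Fin n → (Fin n → ℝ) → ℝ) (e : Fin n → ℝ) (f : (Fin n → ℝ) → ℝ) (i : Fin n)
    (u : Fin n → ℝ) : ℝ :=
  (e i)⁻¹ * pd i (frameGrad h f i) u +
    ∑ m ∈ Finset.univ.erase i, (e m)⁻¹ * rot h m i u * frameGrad h f m u

/-- `∇_i ∇_j f = 0` on `U` for `i ≠ j`. -/
def HasDiagonalHessian (U : Set (Fin n → ℝ)) (h : Fin n → (Fin n → ℝ) → ℝ)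
    (f : (Fin n → ℝ) → ℝ) : Prop :=
  ∀ u ∈ U, ∀ i j, i ≠ j → pd j (frameGrad h f i) u = rot h i j u * frameGrad h f j u

namespace IsLame

variable {g h : Fin n → (Fin n → ℝ) → ℝ} {e : Fin n → ℝ} (L : IsLame U g h e)
include L

theorem smooth_frameGrad {f : (Fin n → ℝ) → ℝ} (hf : ContDiffOn ℝ ∞ f U) (i : Fin n) :
    ContDiffOn ℝ ∞ (frameGrad h f i) U :=
  (smooth_pd L.isOpen hf i).div (L.smooth i) (L.ne_zero i)

theorem smooth_frameHess {f : (Fin n → ℝ) → ℝ} (hf : ContDiffOn ℝ ∞ f U) (i : Fin n) :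
    ContDiffOn ℝ ∞ (frameHess h e f i) U :=
  (contDiffOn_const.mul (smooth_pd L.isOpen (L.smooth_frameGrad hf i) i)).add <|
    ContDiffOn.sum fun m _ =>
      (contDiffOn_const.mul (L.smooth_rot m i)).mul (L.smooth_frameGrad hf m)

theorem pd_eq_frameGrad (f : (Fin n → ℝ) → ℝ) (hu : u ∈ U) (i : Fin n) :
    pd i f u = frameGrad h f i u * h i u := by
  rw [frameGrad, div_mul_cancel₀ _ (L.ne_zero i u hu)]

theorem pd_pd_eq {f : (Fin n → ℝ) → ℝ} (hf : ContDiffOn ℝ ∞ f U) (hu : u ∈ U) (i j : Fin n) :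
    pd j (pd i f) u = pd j (frameGrad h f i) u * h i u +
      frameGrad h f i u * (rot h j i u * h j u) := by
  rw [pd_congr L.isOpen (fun x hx => L.pd_eq_frameGrad f hx i) hu,
    pd_mul L.isOpen (L.smooth_frameGrad hf i) (L.smooth i) hu, L.pd_lame hu]

theorem gradInner_eq (f q : (Fin n → ℝ) → ℝ) (hu : u ∈ U) :
    gradInner g f q u = ∑ m, (e m)⁻¹ * frameGrad h f m u * frameGrad h q m u := by
  refine Finset.sum_congr rfl fun m _ => ?_
  have := L.ne_zero m u hu
  have := L.sign_ne_zero m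
  rw [L.eq u hu, L.pd_eq_frameGrad f hu, L.pd_eq_frameGrad q hu]
  field_simp

theorem smooth_gradInner {f q : (Fin n → ℝ) → ℝ} (hf : ContDiffOn ℝ ∞ f U)
    (hq : ContDiffOn ℝ ∞ q U) : ContDiffOn ℝ ∞ (gradInner g f q) U := by
  refine ContDiffOn.congr (ContDiffOn.sum fun m _ => ?_) fun x hx => L.gradInner_eq f q hx
  exact (contDiffOn_const.mul (L.smooth_frameGrad hf m)).mul (L.smooth_frameGrad hq m)

/-- The derivative pairs the Hessian of each function with the gradient of the other; diagonality
leaves only the `i`-th terms. -/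
theorem pd_gradInner {f q : (Fin n → ℝ) → ℝ} (hf : ContDiffOn ℝ ∞ f U) (hq : ContDiffOn ℝ ∞ q U)
    (Hf : HasDiagonalHessian U h f) (Hq : HasDiagonalHessian U h q) (hu : u ∈ U) (i : Fin n) :
    pd i (gradInner g f q) u =
      frameGrad h q i u * frameHess h e f i u + frameGrad h f i u * frameHess h e q i u := by
  have sf := L.smooth_frameGrad hf
  have sq := L.smooth_frameGrad hq
  have term : ∀ m, pd i (fun x => (e m)⁻¹ * frameGrad h f m x * frameGrad h q m x) u =
      (e m)⁻¹ * (pd i (frameGrad h f m) u * frameGrad h q m u +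
        frameGrad h f m u * pd i (frameGrad h q m) u) := fun m => by
    simp only [mul_assoc]
    rw [pd_const_mul L.isOpen ((sf m).mul (sq m)) hu, pd_mul L.isOpen (sf m) (sq m) hu]
  rw [pd_congr L.isOpen (fun x hx => L.gradInner_eq f q hx) hu,
    pd_sum L.isOpen _ (fun m _ => (contDiffOn_const.mul (sf m)).mul (sq m)) hu,
    Finset.sum_congr rfl fun m _ => term m, ← Finset.add_sum_erase _ _ (Finset.mem_univ i),
    frameHess, frameHess]
  have : ∑ m ∈ Finset.univ.erase i, (e m)⁻¹ * (pd i (frameGrad h f m) u * frameGrad h q m u +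
        frameGrad h f m u * pd i (frameGrad h q m) u) =
      frameGrad h q i u * (∑ m ∈ Finset.univ.erase i, (e m)⁻¹ * rot h m i u * frameGrad h f m u) +
      frameGrad h f i u *
        ∑ m ∈ Finset.univ.erase i, (e m)⁻¹ * rot h m i u * frameGrad h q m u := by
    rw [Finset.mul_sum, Finset.mul_sum, ← Finset.sum_add_distrib]
    refine Finset.sum_congr rfl fun m hm => ?_
    rw [Hf u hu m i (Finset.ne_of_mem_erase hm), Hq u hu m i (Finset.ne_of_mem_erase hm)]
    ring
  rw [this]
  ring

/-- The Codazzi equations for the tensor `∇_i ∇_j f + K f g_{ij}` in curvature `K`. -/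
theorem pd_codazzi {K : ℝ} (hK : HasConstantCurvature U g K) {f : (Fin n → ℝ) → ℝ}
    (hf : ContDiffOn ℝ ∞ f U) (Hf : HasDiagonalHessian U h f) (hu : u ∈ U) {i j : Fin n}
    (hij : i ≠ j) :
    pd j (fun x => frameHess h e f i x + K * f x * h i x) u =
      rot h j i u * (frameHess h e f j u + K * f u * h j u) := by
  have sf := L.smooth_frameGrad hf
  have s1 : ∀ m, ContDiffOn ℝ ∞ (fun x => (e m)⁻¹ * rot h m i x * frameGrad h f m x) U :=
    fun m => (contDiffOn_const.mul (L.smooth_rot m i)).mul (sf m)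
  have s2 : ContDiffOn ℝ ∞ (fun x => (e i)⁻¹ * pd i (frameGrad h f i) x) U :=
    contDiffOn_const.mul (smooth_pd L.isOpen (sf i) i)
  have d2 : pd j (pd i (frameGrad h f i)) u =
      pd i (rot h i j) u * frameGrad h f j u + rot h i j u * (rot h j i u * frameGrad h f i u) := by
    rw [pd_comm L.isOpen (sf i) hu, pd_congr L.isOpen (fun x hx => Hf x hx i j hij) hu,
      pd_mul L.isOpen (L.smooth_rot i j) (sf j) hu, Hf u hu j i hij.symm]
  have dt : ∀ m, pd j (fun x => (e m)⁻¹ * rot h m i x * frameGrad h f m x) u =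
      (e m)⁻¹ * (pd j (rot h m i) u * frameGrad h f m u +
        rot h m i u * pd j (frameGrad h f m) u) := fun m => by
    simp only [mul_assoc]
    rw [pd_const_mul L.isOpen ((L.smooth_rot m i).mul (sf m)) hu,
      pd_mul L.isOpen (L.smooth_rot m i) (sf m) hu]
  have dK : pd j (fun x => K * f x * h i x) u =
      K * (pd j f u * h i u + f u * (rot h j i u * h j u)) := by
    simp only [mul_assoc]
    rw [pd_const_mul L.isOpen (hf.mul (L.smooth i)) hu, pd_mul L.isOpen hf (L.smooth i) hu,
      L.pd_lame hu]
  rw [pd_add L.isOpen (L.smooth_frameHess hf i) ((contDiffOn_const.mul hf).mul (L.smooth i)) hu, dK]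
  unfold frameHess
  rw [pd_add L.isOpen s2 (ContDiffOn.sum fun m _ => s1 m) hu,
    pd_const_mul L.isOpen (smooth_pd L.isOpen (sf i) i) hu, d2,
    pd_sum L.isOpen _ (fun m _ => s1 m) hu, Finset.sum_congr rfl fun m _ => dt m,
    sum_erase_erase' hij, sum_erase_erase' hij.symm]
  have hs : ∑ m ∈ (Finset.univ.erase i).erase j, (e m)⁻¹ *
      (pd j (rot h m i) u * frameGrad h f m u + rot h m i u * pd j (frameGrad h f m) u) =
      rot h j i u * (∑ m ∈ (Finset.univ.erase i).erase j,
        (e m)⁻¹ * rot h m j u * frameGrad h f m u) + frameGrad h f j u *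
        ∑ m ∈ (Finset.univ.erase i).erase j, (e m)⁻¹ * rot h m i u * rot h m j u := by
    rw [Finset.mul_sum, Finset.mul_sum, ← Finset.sum_add_distrib]
    refine Finset.sum_congr rfl fun m hm => ?_
    have hmj := Finset.ne_of_mem_erase hm
    have hmi := Finset.ne_of_mem_erase (Finset.mem_of_mem_erase hm)
    rw [Hf u hu m j hmj, L.pd_rot_of_hasConstantCurvature hK hu hmi hmj hij]
    ring
  -- The terms containing `∂_j f / h_j` assemble into the bracket, whose value `-K h_i h_j` cancels
  -- the term `K ∂_j f h_i`.
  have hc := L.rotCurvature_eq_of_hasConstantCurvature hK hu hij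
  rw [rotCurvature] at hc
  rw [hs, Finset.erase_right_comm (a := j), L.pd_eq_frameGrad f hu j]
  linear_combination frameGrad h f j u * hc

end IsLame

/-! ### The pointwise form of the Hamiltonian condition -/

theorem IsHamiltonian.eq_hessian {v g : Fin n → (Fin n → ℝ) → ℝ} {H : (Fin n → ℝ) → ℝ} {K : ℝ}
    (hU : IsOpen U) (hH : ContDiffOn ℝ ∞ H U) (hh : IsHamiltonian U g K v H) (hu : u ∈ U)
    (i k : Fin n) :
    (if i = k then v i u else 0) = (g i u)⁻¹ * (pd k (pd i H) u -
      ∑ j, christoffel g j i k u * pd j H u) + (if i = k then K * H u else 0) := by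
  obtain ⟨ε, hε, hball⟩ := Metric.isOpen_iff.1 hU u hu
  -- Both sides are linear in `u_x`, so velocities along one axis suffice. The field must stay in
  -- `U` for all real `x`; the bounded sine ensures this.
  set w : ℝ → Fin n → ℝ := fun x => u + (ε / 2 * Real.sin x) • Pi.single k 1 with hw
  have hwU : ∀ x, w x ∈ U := fun x => hball <| by
    rw [Metric.mem_ball, hw, dist_eq_norm]
    simp only [add_sub_cancel_left, norm_smul, Real.norm_eq_abs, Pi.norm_single, norm_one, mul_one,
      abs_mul, abs_of_pos (half_pos hε)]
    have := Real.abs_sin_le_one x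
    nlinarith
  have hws : ContDiff ℝ ∞ w :=
    contDiff_const.add ((contDiff_const.mul Real.contDiff_sin).smul contDiff_const)
  have hw0 : w 0 = u := by simp [hw]
  have hwd : HasDerivAt w ((ε / 2) • Pi.single k 1) 0 := by
    have := (((Real.hasDerivAt_sin 0).const_mul (ε / 2)).smul_const
      (Pi.single k 1 : Fin n → ℝ)).const_add u
    simpa [hw] using this
  have hwc : ∀ j, deriv (fun y => w y j) 0 = if k = j then ε / 2 else 0 := fun j => by
    have := (hasDerivAt_pi.1 hwd j).deriv
    rw [this]
    simp [Pi.single_apply, eq_comm]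
  have hdH : deriv (fun y => pd i H (w y)) 0 = ε / 2 * pd k (pd i H) u := by
    have h1 : HasFDerivAt (pd i H) (fderiv ℝ (pd i H) u) (w 0) := by
      rw [hw0]
      exact (differentiableAt_of_smooth hU (smooth_pd hU hH i) hu).hasFDerivAt
    have h2 := h1.comp_hasDerivAt 0 hwd
    rw [map_smul, smul_eq_mul] at h2
    exact h2.deriv
  have key := hh w hws hwU i 0
  rw [hamiltonianFlow, hdH] at key
  simp only [hwc, hw0] at key
  have hsum : ∑ j, ∑ k', christoffel g j i k' u * (if k = k' then ε / 2 else 0) * pd j H u =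
      ε / 2 * ∑ j, christoffel g j i k u * pd j H u := by
    simp only [mul_ite, mul_zero, ite_mul, zero_mul, Finset.sum_ite_eq, Finset.mem_univ, if_true,
      Finset.mul_sum]
    exact Finset.sum_congr rfl fun _ _ => by ring
  rw [hsum] at key
  have hε2 : ε / 2 ≠ 0 := by positivity
  apply mul_left_cancel₀ hε2
  by_cases hik : i = k
  · rw [if_pos hik.symm] at key
    rw [if_pos hik, if_pos hik]
    linear_combination key
  · rw [if_neg (Ne.symm hik)] at key
    rw [if_neg hik, if_neg hik]
    linear_combination key

/-! ### Velocities and densities in terms of rotation coefficients. -/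

namespace IsLame

variable {v g h : Fin n → (Fin n → ℝ) → ℝ} {e : Fin n → ℝ} (L : IsLame U g h e)
include L

theorem hasDiagonalHessian_of_isHamiltonian {H : (Fin n → ℝ) → ℝ} {K : ℝ}
    (hH : ContDiffOn ℝ ∞ H U) (hh : IsHamiltonian U g K v H) : HasDiagonalHessian U h H := by
  intro u hu i j hij
  have h1 := L.ne_zero i u hu
  have h2 := L.ne_zero j u hu
  have h3 := L.sign_ne_zero i
  have key := hh.eq_hessian L.isOpen hH hu i j
  simp only [if_neg hij, L.christoffel_eq hu, sub_zero, add_zero, add_mul, ite_mul, zero_mul,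
    Finset.sum_add_distrib, Finset.sum_ite_eq', Finset.mem_univ, if_true] at key
  have hg : (g i u)⁻¹ ≠ 0 := by
    rw [L.eq u hu]
    exact inv_ne_zero (mul_ne_zero h3 (pow_ne_zero 2 h1))
  have key := (mul_eq_zero.1 key.symm).resolve_left hg
  rw [L.pd_pd_eq hH hu, L.pd_eq_frameGrad H hu, L.pd_eq_frameGrad H hu] at key
  field_simp at key
  apply mul_left_cancel₀ h1
  linear_combination key

theorem velocity_eq_of_isHamiltonian {H : (Fin n → ℝ) → ℝ} {K : ℝ}
    (hH : ContDiffOn ℝ ∞ H U) (hh : IsHamiltonian U g K v H) (hu : u ∈ U) (i : Fin n) :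
    v i u * h i u = frameHess h e H i u + K * H u * h i u := by
  have h1 := L.ne_zero i u hu
  have h3 := L.sign_ne_zero i
  have key := hh.eq_hessian L.isOpen hH hu i i
  simp only [if_true, L.christoffel_eq hu, add_mul, sub_mul, ite_mul, zero_mul,
    Finset.sum_add_distrib, Finset.sum_sub_distrib, Finset.sum_ite_eq', Finset.mem_univ] at key
  have hs : ∑ m, e i / e m * (h i u / h m u) * rot h m i u * pd m H u =
      e i * h i u * (∑ m ∈ Finset.univ.erase i, (e m)⁻¹ * rot h m i u * frameGrad h H m u) +
      rot h i i u * pd i H u := by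
    rw [← Finset.add_sum_erase _ _ (Finset.mem_univ i), add_comm, Finset.mul_sum]
    congr 1
    · refine Finset.sum_congr rfl fun m _ => ?_
      have := L.ne_zero m u hu
      have := L.sign_ne_zero m
      rw [L.pd_eq_frameGrad H hu]
      field_simp
    · field_simp
  rw [hs, L.pd_pd_eq hH hu, L.eq u hu, L.pd_eq_frameGrad H hu] at key
  rw [key, frameHess]
  field_simp
  ring

/-- Both `h` and `v h` solve the linear system with coefficients `β`. -/
theorem pd_velocity_mul {H : (Fin n → ℝ) → ℝ} {K : ℝ} (hK : HasConstantCurvature U g K)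
    (hH : ContDiffOn ℝ ∞ H U) (hh : IsHamiltonian U g K v H) (hv : ∀ i, ContDiffOn ℝ ∞ (v i) U)
    (hu : u ∈ U) {i j : Fin n} (hij : i ≠ j) :
    pd j (v i) u * h i u = rot h j i u * h j u * (v j u - v i u) := by
  have key := L.pd_codazzi hK hH (L.hasDiagonalHessian_of_isHamiltonian hH hh) hu hij
  rw [← L.velocity_eq_of_isHamiltonian hH hh hu, ← pd_congr L.isOpen
    (fun x hx => L.velocity_eq_of_isHamiltonian hH hh hx i) hu,
    pd_mul L.isOpen (hv i) (L.smooth i) hu, L.pd_lame hu] at key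
  linear_combination key

/-- Equality of the mixed derivatives of `F` expresses `(v^j - v^i) ∂_i ∂_j P` through `∂_i v^j` and
`∂_j v^i`. Here `hvh` turns those into rotation coefficients, and strict hyperbolicity permits the
division. -/
theorem hasDiagonalHessian_of_isConservationLaw
    (hv : ∀ i, ContDiffOn ℝ ∞ (v i) U) (hyp : ∀ u ∈ U, ∀ i j, i ≠ j → v i u ≠ v j u)
    (hvh : ∀ u ∈ U, ∀ i j, i ≠ j →
      pd j (v i) u * h i u = rot h j i u * h j u * (v j u - v i u))
    {P F : (Fin n → ℝ) → ℝ} (hP : ContDiffOn ℝ ∞ P U) (hF : ContDiffOn ℝ ∞ F U)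
    (hPF : IsConservationLaw U v P F) : HasDiagonalHessian U h P := by
  intro u hu i j hij
  have h1 := L.ne_zero i u hu
  have h2 := L.ne_zero j u hu
  have c := pd_comm L.isOpen hF hu i j
  rw [pd_congr L.isOpen (fun x hx => hPF x hx j) hu, pd_congr L.isOpen (fun x hx => hPF x hx i) hu,
    pd_mul L.isOpen (hv j) (smooth_pd L.isOpen hP j) hu,
    pd_mul L.isOpen (hv i) (smooth_pd L.isOpen hP i) hu, pd_comm L.isOpen hP hu i j,
    L.pd_pd_eq hP hu, L.pd_eq_frameGrad P hu, L.pd_eq_frameGrad P hu] at c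
  have k1 := hvh u hu i j hij
  have k2 := hvh u hu j i hij.symm
  have h5 : (v j u - v i u) * h i u ≠ 0 :=
    mul_ne_zero (sub_ne_zero.2 (hyp u hu i j hij).symm) h1
  apply mul_left_cancel₀ h5
  linear_combination c - frameGrad h P j u * k2 + frameGrad h P i u * k1

end IsLame

/-! ### Reciprocal transformations -/

/-- The reciprocal Lamé coefficient `ĥ_j = h_j (M - N v^j) / (B M - A N)`. -/
def recipLame (v h : Fin n → (Fin n → ℝ) → ℝ) (B A N M : (Fin n → ℝ) → ℝ) (j : Fin n)
    (u : Fin n → ℝ) : ℝ :=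
  h j u * (M u - N u * v j u) / (B u * M u - A u * N u)

/-- The second solution `h_j (B v^j - A) / (B M - A N)` of the reciprocal linear system. -/
def recipLame₂ (v h : Fin n → (Fin n → ℝ) → ℝ) (B A N M : (Fin n → ℝ) → ℝ) (j : Fin n)
    (u : Fin n → ℝ) : ℝ :=
  h j u * (B u * v j u - A u) / (B u * M u - A u * N u)

/-- The reciprocal rotation coefficients. -/
def recipRot (v h : Fin n → (Fin n → ℝ) → ℝ) (B A N M : (Fin n → ℝ) → ℝ) (i j : Fin n)
    (u : Fin n → ℝ) : ℝ :=
  rot h i j u - frameGrad h B i u * recipLame v h B A N M j u -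
    frameGrad h N i u * recipLame₂ v h B A N M j u

/-- A reciprocal transformation of a strictly hyperbolic diagonal system that is compatible with
a diagonal metric of constant curvature `K`. -/
structure IsReciprocal (U : Set (Fin n → ℝ)) (v g h : Fin n → (Fin n → ℝ) → ℝ) (e : Fin n → ℝ)
    (K : ℝ) (B A N M : (Fin n → ℝ) → ℝ) : Prop where
  lame : IsLame U g h e
  curvature : HasConstantCurvature U g K
  smooth_v : ∀ i, ContDiffOn ℝ ∞ (v i) U
  smooth_B : ContDiffOn ℝ ∞ B U
  smooth_A : ContDiffOn ℝ ∞ A U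
  smooth_N : ContDiffOn ℝ ∞ N U
  smooth_M : ContDiffOn ℝ ∞ M U
  hyperbolic : ∀ u ∈ U, ∀ i j, i ≠ j → v i u ≠ v j u
  pd_v : ∀ u ∈ U, ∀ i j, i ≠ j → pd j (v i) u * h i u = rot h j i u * h j u * (v j u - v i u)
  hess_B : HasDiagonalHessian U h B
  hess_N : HasDiagonalHessian U h N
  pd_A : IsConservationLaw U v B A
  pd_M : IsConservationLaw U v N M
  det_ne_zero : ∀ u ∈ U, B u * M u - A u * N u ≠ 0
  den_ne_zero : ∀ u ∈ U, ∀ i, M u - N u * v i u ≠ 0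

theorem recipRot_mul_sq {D : ℝ} (hD : D ≠ 0) (r a b x y z : ℝ) :
    (r - a * (x / D) - b * (y / D)) * (z / D) * D ^ 2 = (r * D - a * x - b * y) * z := by
  field_simp

namespace IsReciprocal

variable {v g h : Fin n → (Fin n → ℝ) → ℝ} {e : Fin n → ℝ} {K : ℝ} {B A N M : (Fin n → ℝ) → ℝ}
  (S : IsReciprocal U v g h e K B A N M)
include S

theorem isOpen : IsOpen U := S.lame.isOpen

theorem smooth_det : ContDiffOn ℝ ∞ (fun x => B x * M x - A x * N x) U :=
  (S.smooth_B.mul S.smooth_M).sub (S.smooth_A.mul S.smooth_N)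

theorem smooth_recipLame (j : Fin n) : ContDiffOn ℝ ∞ (recipLame v h B A N M j) U :=
  ((S.lame.smooth j).mul (S.smooth_M.sub (S.smooth_N.mul (S.smooth_v j)))).div S.smooth_det
    S.det_ne_zero

theorem smooth_recipLame₂ (j : Fin n) : ContDiffOn ℝ ∞ (recipLame₂ v h B A N M j) U :=
  ((S.lame.smooth j).mul ((S.smooth_B.mul (S.smooth_v j)).sub S.smooth_A)).div S.smooth_det
    S.det_ne_zero

theorem isLame : IsLame U (reciprocalMetric v g B A N M) (recipLame v h B A N M) e where
  isOpen := S.isOpen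
  smooth := S.smooth_recipLame
  ne_zero i u hu := div_ne_zero (mul_ne_zero (S.lame.ne_zero i u hu) (S.den_ne_zero u hu i))
    (S.det_ne_zero u hu)
  sign_ne_zero := S.lame.sign_ne_zero
  eq u hu i := by
    rw [reciprocalMetric, recipLame, S.lame.eq u hu]
    ring

/-- Together with `velocity_mul_lame_eq` this is Cramer's rule: `x`, `y` solve a 2×2 system of
determinant `B M - A N` with right-hand sides `h`, `v h`. -/
theorem lame_eq (hu : u ∈ U) (j : Fin n) :
    h j u = B u * recipLame v h B A N M j u + N u * recipLame₂ v h B A N M j u := by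
  have := S.det_ne_zero u hu
  rw [recipLame, recipLame₂, ← mul_div_assoc, ← mul_div_assoc, ← add_div, eq_div_iff this]
  ring

theorem velocity_mul_lame_eq (hu : u ∈ U) (j : Fin n) :
    v j u * h j u = A u * recipLame v h B A N M j u + M u * recipLame₂ v h B A N M j u := by
  have := S.det_ne_zero u hu
  rw [recipLame, recipLame₂, ← mul_div_assoc, ← mul_div_assoc, ← add_div, eq_div_iff this]
  ring

theorem pd_det (hu : u ∈ U) (i : Fin n) :
    pd i (fun x => B x * M x - A x * N x) u =
      frameGrad h B i u * (h i u * (M u - N u * v i u)) +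
      frameGrad h N i u * (h i u * (B u * v i u - A u)) := by
  rw [pd_sub S.isOpen (S.smooth_B.mul S.smooth_M) (S.smooth_A.mul S.smooth_N) hu,
    pd_mul S.isOpen S.smooth_B S.smooth_M hu, pd_mul S.isOpen S.smooth_A S.smooth_N hu,
    S.pd_A u hu, S.pd_M u hu, S.lame.pd_eq_frameGrad B hu, S.lame.pd_eq_frameGrad N hu]
  ring

/-- Differentiate `h = B x + N y` and `v h = A x + M y`. As `∂_i A = v^i ∂_i B` and `∂_i M = v^i ∂_i
N`, the derivatives of the coefficients are absorbed into `recipRot`, the same for `x` and `y`. -/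
theorem pd_recipLame (hu : u ∈ U) {i j : Fin n} (hij : i ≠ j) :
    pd i (recipLame v h B A N M j) u =
      recipRot v h B A N M i j u * recipLame v h B A N M i u := by
  have h0 := S.det_ne_zero u hu
  have h1 := S.pd_v u hu j i hij.symm
  have sNv := S.smooth_N.mul (S.smooth_v j)
  unfold recipRot recipLame recipLame₂
  rw [pd_div S.isOpen ((S.lame.smooth j).mul (S.smooth_M.sub sNv)) S.smooth_det S.det_ne_zero hu,
    S.pd_det hu, pd_mul S.isOpen (S.lame.smooth j) (S.smooth_M.sub sNv) hu,
    pd_sub S.isOpen S.smooth_M sNv hu, pd_mul S.isOpen S.smooth_N (S.smooth_v j) hu,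
    S.pd_M u hu, S.lame.pd_eq_frameGrad N hu, S.lame.pd_lame hu, div_eq_iff (pow_ne_zero 2 h0),
    recipRot_mul_sq h0]
  linear_combination -(N u * (B u * M u - A u * N u)) * h1

theorem pd_recipLame₂ (hu : u ∈ U) {i j : Fin n} (hij : i ≠ j) :
    pd i (recipLame₂ v h B A N M j) u =
      recipRot v h B A N M i j u * recipLame₂ v h B A N M i u := by
  have h0 := S.det_ne_zero u hu
  have h1 := S.pd_v u hu j i hij.symm
  have sBv := S.smooth_B.mul (S.smooth_v j)
  unfold recipRot recipLame recipLame₂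
  rw [pd_div S.isOpen ((S.lame.smooth j).mul (sBv.sub S.smooth_A)) S.smooth_det S.det_ne_zero hu,
    S.pd_det hu, pd_mul S.isOpen (S.lame.smooth j) (sBv.sub S.smooth_A) hu,
    pd_sub S.isOpen sBv S.smooth_A hu, pd_mul S.isOpen S.smooth_B (S.smooth_v j) hu,
    S.pd_A u hu, S.lame.pd_eq_frameGrad B hu, S.lame.pd_lame hu, div_eq_iff (pow_ne_zero 2 h0),
    recipRot_mul_sq h0]
  linear_combination (B u * (B u * M u - A u * N u)) * h1

theorem rot_recipLame (hu : u ∈ U) {i j : Fin n} (hij : i ≠ j) :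
    rot (recipLame v h B A N M) i j u = recipRot v h B A N M i j u := by
  rw [rot, S.pd_recipLame hu hij, mul_div_cancel_right₀ _ (S.isLame.ne_zero i u hu)]

theorem pd_recipRot (hu : u ∈ U) (i j k : Fin n) :
    pd k (recipRot v h B A N M i j) u = pd k (rot h i j) u -
      (pd k (frameGrad h B i) u * recipLame v h B A N M j u +
        frameGrad h B i u * pd k (recipLame v h B A N M j) u) -
      (pd k (frameGrad h N i) u * recipLame₂ v h B A N M j u +
        frameGrad h N i u * pd k (recipLame₂ v h B A N M j) u) := by
  have sB := S.lame.smooth_frameGrad S.smooth_B i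
  have sN := S.lame.smooth_frameGrad S.smooth_N i
  have sx := S.smooth_recipLame j
  have sy := S.smooth_recipLame₂ j
  unfold recipRot
  rw [pd_sub S.isOpen ((S.lame.smooth_rot i j).sub (sB.mul sx)) (sN.mul sy) hu,
    pd_sub S.isOpen (S.lame.smooth_rot i j) (sB.mul sx) hu, pd_mul S.isOpen sB sx hu,
    pd_mul S.isOpen sN sy hu]

theorem pd_rot_recipLame (hu : u ∈ U) {i j k : Fin n} (hij : i ≠ j) (hik : i ≠ k) (hjk : j ≠ k) :
    pd k (rot (recipLame v h B A N M) i j) u =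
      rot (recipLame v h B A N M) i k u * rot (recipLame v h B A N M) k j u := by
  rw [pd_congr S.isOpen (fun x hx => S.rot_recipLame hx hij) hu, S.rot_recipLame hu hik,
    S.rot_recipLame hu hjk.symm, S.pd_recipRot hu, S.pd_recipLame hu hjk.symm,
    S.pd_recipLame₂ hu hjk.symm, S.hess_B u hu i k hik, S.hess_N u hu i k hik,
    S.lame.pd_rot_of_hasConstantCurvature S.curvature hu hij hik hjk]
  simp only [recipRot]
  ring

/-- The only obstruction to flatness of `ĝ`. Once `h` is expanded by `lame_eq`, it pairs `(x_i,
y_i)` with `(x_j, y_j)`. -/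
theorem rotCurvature_recipLame (hu : u ∈ U) {i j : Fin n} (hij : i ≠ j) :
    rotCurvature (rot (recipLame v h B A N M)) e i j u = -(K * h i u * h j u) -
      (frameHess h e B i u * recipLame v h B A N M j u +
        frameHess h e B j u * recipLame v h B A N M i u) -
      (frameHess h e N i u * recipLame₂ v h B A N M j u +
        frameHess h e N j u * recipLame₂ v h B A N M i u) +
      gradInner g B B u * recipLame v h B A N M i u * recipLame v h B A N M j u +
      gradInner g B N u * (recipLame v h B A N M i u * recipLame₂ v h B A N M j u +
        recipLame₂ v h B A N M i u * recipLame v h B A N M j u) +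
      gradInner g N N u * recipLame₂ v h B A N M i u * recipLame₂ v h B A N M j u := by
  have hs : ∑ m ∈ (Finset.univ.erase i).erase j, (e m)⁻¹ *
      rot (recipLame v h B A N M) m i u * rot (recipLame v h B A N M) m j u =
      ∑ m ∈ (Finset.univ.erase i).erase j, ((e m)⁻¹ * rot h m i u * rot h m j u +
        (-recipLame v h B A N M j u) * ((e m)⁻¹ * rot h m i u * frameGrad h B m u) +
        (-recipLame v h B A N M i u) * ((e m)⁻¹ * rot h m j u * frameGrad h B m u) +
        (-recipLame₂ v h B A N M j u) * ((e m)⁻¹ * rot h m i u * frameGrad h N m u) +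
        (-recipLame₂ v h B A N M i u) * ((e m)⁻¹ * rot h m j u * frameGrad h N m u) +
        (recipLame v h B A N M i u * recipLame v h B A N M j u) *
          ((e m)⁻¹ * frameGrad h B m u * frameGrad h B m u) +
        (recipLame v h B A N M i u * recipLame₂ v h B A N M j u +
          recipLame₂ v h B A N M i u * recipLame v h B A N M j u) *
          ((e m)⁻¹ * frameGrad h B m u * frameGrad h N m u) +
        (recipLame₂ v h B A N M i u * recipLame₂ v h B A N M j u) *
          ((e m)⁻¹ * frameGrad h N m u * frameGrad h N m u)) := by
    refine Finset.sum_congr rfl fun m hm => ?_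
    have hmj := Finset.ne_of_mem_erase hm
    have hmi := Finset.ne_of_mem_erase (Finset.mem_of_mem_erase hm)
    rw [S.rot_recipLame hu hmi, S.rot_recipLame hu hmj, recipRot, recipRot]
    ring
  simp only [Finset.sum_add_distrib, ← Finset.mul_sum] at hs
  have hc := S.lame.rotCurvature_eq_of_hasConstantCurvature S.curvature hu hij
  rw [rotCurvature] at hc
  rw [rotCurvature, hs, pd_congr S.isOpen (fun x hx => S.rot_recipLame hx hij) hu,
    pd_congr S.isOpen (fun x hx => S.rot_recipLame hx hij.symm) hu, S.pd_recipRot hu,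
    S.pd_recipRot hu, S.pd_recipLame hu hij, S.pd_recipLame hu hij.symm, S.pd_recipLame₂ hu hij,
    S.pd_recipLame₂ hu hij.symm, S.lame.gradInner_eq B B hu, S.lame.gradInner_eq B N hu,
    S.lame.gradInner_eq N N hu, sum_erase_erase hij, sum_erase_erase hij, sum_erase_erase hij]
  simp only [frameHess]
  rw [sum_erase_erase' hij, sum_erase_erase' hij.symm, sum_erase_erase' hij,
    sum_erase_erase' hij.symm, Finset.erase_right_comm (a := j)]
  simp only [recipRot]
  linear_combination hc

end IsReciprocal

/-! ### Linear algebra in the plane -/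

theorem exists_notMem_of_card_lt (s : Finset (Fin n)) (hs : s.card < n) : ∃ a, a ∉ s := by
  by_contra! h
  rw [Finset.eq_univ_iff_forall.2 h, Finset.card_univ, Fintype.card_fin] at hs
  exact lt_irrefl _ hs

/-- Let `S_{ij}` be the left side of `H`, for all `i`, `j`. Take `w` supported on `{a, b, c}` and
`w'` on `{a, d, f}`, each orthogonal to both `p` and `q`. Every term of `S` has a factor `p` or `q`
in one index, so `wᵀ S w' = 0`. Off-diagonal entries vanish and only `a` is shared, leaving `w_a
w'_a S_{aa} = 0`. Five distinct indices are needed. -/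
theorem diag_eq_zero_of_five_le (hn : 5 ≤ n) {p q x y : Fin n → ℝ}
    (hpq : ∀ i j, i ≠ j → p i * q j - p j * q i ≠ 0)
    (H : ∀ i j, i ≠ j → x i * p j + x j * p i + (y i * q j + y j * q i) = 0) (a : Fin n) :
    x a * p a + y a * q a = 0 := by
  have card4 : ∀ a b c d : Fin n, ({a, b, c, d} : Finset (Fin n)).card < n := fun a b c d =>
    lt_of_le_of_lt Finset.card_le_four (by omega)
  obtain ⟨b, hb⟩ := exists_notMem_of_card_lt {a, a, a, a} (card4 a a a a)
  obtain ⟨c, hc⟩ := exists_notMem_of_card_lt {a, b, b, b} (card4 a b b b)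
  obtain ⟨d, hd⟩ := exists_notMem_of_card_lt {a, b, c, c} (card4 a b c c)
  obtain ⟨f, hf⟩ := exists_notMem_of_card_lt {a, b, c, d} (card4 a b c d)
  simp only [Finset.mem_insert, Finset.mem_singleton, not_or] at hb hc hd hf
  apply mul_left_cancel₀ (mul_ne_zero (hpq b c (Ne.symm hc.2.1)) (hpq d f (Ne.symm hf.2.2.2)))
  linear_combination (1 / 2 : ℝ) *
    (-(p b * q c - p c * q b) * (p f * q a - p a * q f) * H a d (Ne.symm hd.1)
    - (p b * q c - p c * q b) * (p a * q d - p d * q a) * H a f (Ne.symm hf.1)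
    - (p c * q a - p a * q c) * (p d * q f - p f * q d) * H b a hb.1
    - (p c * q a - p a * q c) * (p f * q a - p a * q f) * H b d (Ne.symm hd.2.1)
    - (p c * q a - p a * q c) * (p a * q d - p d * q a) * H b f (Ne.symm hf.2.1)
    - (p a * q b - p b * q a) * (p d * q f - p f * q d) * H c a hc.1
    - (p a * q b - p b * q a) * (p f * q a - p a * q f) * H c d (Ne.symm hd.2.2.1)
    - (p a * q b - p b * q a) * (p a * q d - p d * q a) * H c f (Ne.symm hf.2.2.1))

/-- The vanishing diagonal gives `(x_i, y_i) = l_i (q_i, -p_i)`; then `H` reads `(l_i - l_j)(q_i p_j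
- p_i q_j) = 0`, so all `l_i` agree. -/
theorem exists_mul_of_five_le (hn : 5 ≤ n) {p q x y : Fin n → ℝ}
    (hpq : ∀ i j, i ≠ j → p i * q j - p j * q i ≠ 0)
    (H : ∀ i j, i ≠ j → x i * p j + x j * p i + (y i * q j + y j * q i) = 0) :
    ∃ l : ℝ, ∀ i, x i = l * q i ∧ y i = -(l * p i) := by
  have hd := diag_eq_zero_of_five_le hn hpq H
  let a : Fin n := ⟨0, by omega⟩
  let b : Fin n := ⟨1, by omega⟩
  have hab : a ≠ b := by simp [a, b]
  have h0 := hpq a b hab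
  obtain ⟨l, hl⟩ : ∃ l : ℝ, x a * p b + y a * q b = -(l * (p a * q b - p b * q a)) :=
    ⟨-(x a * p b + y a * q b) / (p a * q b - p b * q a), by
      rw [neg_div, neg_mul, neg_neg, div_mul_cancel₀ _ h0]⟩
  have ha : x a = l * q a ∧ y a = -(l * p a) := by
    constructor <;> apply mul_left_cancel₀ h0
    · linear_combination q b * hd a - q a * hl
    · linear_combination -p b * hd a + p a * hl
  refine ⟨l, fun i => ?_⟩
  by_cases hai : a = i
  · exact hai ▸ ha
  have h1 := hpq a i hai
  have h2 := H a i hai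
  rw [ha.1, ha.2] at h2
  constructor <;> apply mul_left_cancel₀ h1
  · linear_combination q i * h2 - q a * hd i
  · linear_combination -p i * h2 + p a * hd i

theorem exists_solution {a b m k : ℝ} (hD : b * m - a * k ≠ 0) (r s : ℝ) :
    ∃ x y : ℝ, x * a + y * b = r ∧ x * m + y * k = s := by
  refine ⟨(-r * k + s * b) / (b * m - a * k), (r * m - s * a) / (b * m - a * k), ?_, ?_⟩ <;>
    rw [div_mul_eq_mul_div, div_mul_eq_mul_div, ← add_div, div_eq_iff hD] <;> ring

/-! ### Flatness of the reciprocal metric -/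

/-- The general form of the alternatives, for an initial metric of constant curvature `K`. -/
def MainAlternative (U : Set (Fin n → ℝ)) (g : Fin n → (Fin n → ℝ) → ℝ) (K : ℝ)
    (B A N M : (Fin n → ℝ) → ℝ) : Prop :=
  ∃ κ₁ κ₂ κ₃ κ₄ : ℝ, ∀ u ∈ U,
    gradInner g B B u + K * B u ^ 2 = 2 * κ₁ * A u + 2 * κ₂ * B u ∧
    gradInner g N N u + K * N u ^ 2 = 2 * κ₃ * M u + 2 * κ₄ * N u ∧
    gradInner g B N u + K * B u * N u = κ₁ * M u + κ₂ * N u + κ₃ * A u + κ₄ * B u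

theorem IsFlat.hasConstantCurvature {g : Fin n → (Fin n → ℝ) → ℝ} (h : IsFlat U g) :
    HasConstantCurvature U g 0 := fun u hu l k i j => by rw [h u hu, zero_mul]

namespace IsReciprocal

variable {v g h : Fin n → (Fin n → ℝ) → ℝ} {e : Fin n → ℝ} {K : ℝ} {B A N M : (Fin n → ℝ) → ℝ}
  (S : IsReciprocal U v g h e K B A N M)
include S

theorem exists_affine_of_isFlat (hn : 5 ≤ n) (hflat : IsFlat U (reciprocalMetric v g B A N M))
    (hu : u ∈ U) : ∃ κ₁ κ₂ κ₃ κ₄ : ℝ,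
      (∀ i, frameHess h e B i u + K * B u * h i u = (κ₁ * v i u + κ₂) * h i u) ∧
      (∀ i, frameHess h e N i u + K * N u * h i u = (κ₃ * v i u + κ₄) * h i u) ∧
      gradInner g B B u + K * B u ^ 2 = 2 * κ₁ * A u + 2 * κ₂ * B u ∧
      gradInner g N N u + K * N u ^ 2 = 2 * κ₃ * M u + 2 * κ₄ * N u ∧
      gradInner g B N u + K * B u * N u = κ₁ * M u + κ₂ * N u + κ₃ * A u + κ₄ * B u := by
  have h0 := S.det_ne_zero u hu
  set p := fun i => recipLame v h B A N M i u with hp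
  set q := fun i => recipLame₂ v h B A N M i u with hq
  have hh : ∀ i, h i u = B u * p i + N u * q i := S.lame_eq hu
  have hvh : ∀ i, v i u * h i u = A u * p i + M u * q i := S.velocity_mul_lame_eq hu
  -- Half the coefficients of the quadratic part of the bracket after `h_i h_j` is expanded in `x`,
  -- `y`; each half is absorbed into one Hessian term.
  set P₁ := (gradInner g B B u - K * B u ^ 2) / 2 with hP₁
  set P₂ := (gradInner g B N u - K * B u * N u) / 2 with hP₂
  set P₃ := (gradInner g N N u - K * N u ^ 2) / 2 with hP₃
  obtain ⟨l, hl⟩ := exists_mul_of_five_le hn (p := p) (q := q)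
    (x := fun i => frameHess h e B i u - P₁ * p i - P₂ * q i)
    (y := fun i => frameHess h e N i u - P₂ * p i - P₃ * q i)
    (by
      -- Passing from `x, y` to `h, v h` multiplies the determinant by `B M - A N` and gives `(v^j -
      -- v^i) h_i h_j`.
      intro i j hij hpq
      have : (v j u - v i u) * (h i u * h j u) = 0 := by
        linear_combination (hvh j) * h i u - (hvh i) * h j u + (A u * p j + M u * q j) * hh i -
          (A u * p i + M u * q i) * hh j + (B u * M u - A u * N u) * hpq
      exact mul_ne_zero (sub_ne_zero.2 (S.hyperbolic u hu i j hij).symm)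
        (mul_ne_zero (S.lame.ne_zero i u hu) (S.lame.ne_zero j u hu)) this)
    (by
      intro i j hij
      have h1 := S.isLame.rotCurvature_eq_of_hasConstantCurvature hflat.hasConstantCurvature hu hij
      rw [S.rotCurvature_recipLame hu hij, hh i, hh j] at h1
      simp only [hP₁, hP₂, hP₃]
      linear_combination -h1)
  -- The Hessian terms are re-expanded from `x`, `y` into `v h`, `h`. The unknown `l` enters the two
  -- systems with opposite signs and cancels in the mixed gradient relation.
  obtain ⟨k₁, k₂, hk₁, hk₂⟩ : ∃ k₁ k₂ : ℝ, k₁ * A u + k₂ * B u = P₁ ∧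
      k₁ * M u + k₂ * N u = P₂ + l :=
    exists_solution h0 _ _
  obtain ⟨k₃, k₄, hk₃, hk₄⟩ : ∃ k₃ k₄ : ℝ, k₃ * A u + k₄ * B u = P₂ - l ∧
      k₃ * M u + k₄ * N u = P₃ :=
    exists_solution h0 _ _
  refine ⟨k₁, k₂ + K * B u, k₃, k₄ + K * N u, fun i => ?_, fun i => ?_, ?_, ?_, ?_⟩
  · linear_combination (hl i).1 - p i * hk₁ - q i * hk₂ - k₁ * hvh i - k₂ * hh i
  · linear_combination (hl i).2 - p i * hk₃ - q i * hk₄ - k₃ * hvh i - k₄ * hh i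
  · linear_combination -2 * hk₁ - 2 * hP₁
  · linear_combination -2 * hk₄ - 2 * hP₃
  · linear_combination -hk₂ - hk₃ - 2 * hP₂

theorem exists_const_of_affine (hn : 3 ≤ n) {f κ₁ κ₂ : (Fin n → ℝ) → ℝ}
    (hf : ContDiffOn ℝ ∞ f U) (Hf : HasDiagonalHessian U h f) (hc : IsConnected U)
    (hW : ∀ u ∈ U, ∀ i,
      frameHess h e f i u + K * f u * h i u = (κ₁ u * v i u + κ₂ u) * h i u) :
    ∃ a b : ℝ, ∀ u ∈ U, κ₁ u = a ∧ κ₂ u = b := by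
  let i₀ : Fin n := ⟨0, by omega⟩
  let i₁ : Fin n := ⟨1, by omega⟩
  have hi : i₀ ≠ i₁ := by simp [i₀, i₁]
  have sW : ∀ i, ContDiffOn ℝ ∞ (fun x => (frameHess h e f i x + K * f x * h i x) / h i x) U :=
    fun i => ((S.lame.smooth_frameHess hf i).add
      ((contDiffOn_const.mul hf).mul (S.lame.smooth i))).div (S.lame.smooth i) (S.lame.ne_zero i)
  have eW : ∀ u ∈ U, ∀ i, (frameHess h e f i u + K * f u * h i u) / h i u =
      κ₁ u * v i u + κ₂ u := fun u hu i => by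
    rw [hW u hu i, mul_div_cancel_right₀ _ (S.lame.ne_zero i u hu)]
  have s₁ : ContDiffOn ℝ ∞ κ₁ U := by
    refine (((sW i₀).sub (sW i₁)).div ((S.smooth_v i₀).sub (S.smooth_v i₁)) fun u hu =>
      sub_ne_zero.2 (S.hyperbolic u hu _ _ hi)).congr fun u hu => ?_
    change κ₁ u = ((frameHess h e f i₀ u + K * f u * h i₀ u) / h i₀ u -
      (frameHess h e f i₁ u + K * f u * h i₁ u) / h i₁ u) / (v i₀ u - v i₁ u)
    rw [eW u hu, eW u hu, eq_div_iff (sub_ne_zero.2 (S.hyperbolic u hu _ _ hi))]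
    ring
  have s₂ : ContDiffOn ℝ ∞ κ₂ U := by
    refine ((sW i₀).sub (s₁.mul (S.smooth_v i₀))).congr fun u hu => ?_
    rw [eW u hu]
    ring
  -- Codazzi, with the equation for `∂_j v^i` cancelling all but the derivatives of `κ₁`, `κ₂`. Two
  -- indices `i` different from `j` then separate them.
  have key : ∀ u ∈ U, ∀ i j, i ≠ j → pd j κ₁ u * v i u + pd j κ₂ u = 0 := by
    intro u hu i j hij
    have c := S.lame.pd_codazzi S.curvature hf Hf hu hij
    have sv := s₁.mul (S.smooth_v i)
    rw [pd_congr S.isOpen (fun x hx => hW x hx i) hu, hW u hu j,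
      pd_mul S.isOpen (sv.add s₂) (S.lame.smooth i) hu, pd_add S.isOpen sv s₂ hu,
      pd_mul S.isOpen s₁ (S.smooth_v i) hu, S.lame.pd_lame hu] at c
    apply mul_right_cancel₀ (S.lame.ne_zero i u hu)
    linear_combination c - κ₁ u * S.pd_v u hu i j hij
  have zero : ∀ u ∈ U, ∀ j, pd j κ₁ u = 0 ∧ pd j κ₂ u = 0 := by
    intro u hu j
    obtain ⟨a, ha⟩ := exists_notMem_of_card_lt {j} (by rw [Finset.card_singleton]; omega)
    obtain ⟨b, hb⟩ := exists_notMem_of_card_lt {j, a}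
      (lt_of_le_of_lt Finset.card_le_two (by omega))
    simp only [Finset.mem_insert, Finset.mem_singleton, not_or] at ha hb
    have k₁ := key u hu a j ha
    have k₂ := key u hu b j hb.1
    have : pd j κ₁ u = 0 := by
      apply mul_right_cancel₀ (sub_ne_zero.2 (S.hyperbolic u hu b a hb.2))
      linear_combination k₂ - k₁
    refine ⟨this, ?_⟩
    rwa [this, zero_mul, zero_add] at k₁
  obtain ⟨a, ha⟩ := eq_const_of_pd_eq_zero S.isOpen hc s₁ fun u hu j => (zero u hu j).1
  obtain ⟨b, hb⟩ := eq_const_of_pd_eq_zero S.isOpen hc s₂ fun u hu j => (zero u hu j).2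
  exact ⟨a, b, fun u hu => ⟨ha u hu, hb u hu⟩⟩

theorem mainAlternative_of_isFlat (hn : 5 ≤ n) (hc : IsConnected U)
    (hflat : IsFlat U (reciprocalMetric v g B A N M)) : MainAlternative U g K B A N M := by
  choose! κ₁ κ₂ κ₃ κ₄ hκ using fun u (hu : u ∈ U) => S.exists_affine_of_isFlat hn hflat hu
  obtain ⟨a₁, a₂, ha⟩ := S.exists_const_of_affine (by omega) S.smooth_B S.hess_B hc
    fun u hu => (hκ u hu).1
  obtain ⟨a₃, a₄, hb⟩ := S.exists_const_of_affine (by omega) S.smooth_N S.hess_N hc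
    fun u hu => (hκ u hu).2.1
  refine ⟨a₁, a₂, a₃, a₄, fun u hu => ?_⟩
  have := (hκ u hu).2.2
  rwa [(ha u hu).1, (ha u hu).2, (hb u hu).1, (hb u hu).2] at this

/-! ### From the gradient relations back to flatness, and the case of constant `B`. -/

theorem frameGrad_relation {P Q : (Fin n → ℝ) → ℝ} (hP : ContDiffOn ℝ ∞ P U)
    (hQ : ContDiffOn ℝ ∞ Q U) (HP : HasDiagonalHessian U h P) (HQ : HasDiagonalHessian U h Q)
    {a₁ a₂ a₃ a₄ : ℝ} (hrel : ∀ u ∈ U,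
      gradInner g P Q u + K * P u * Q u = a₁ * A u + a₂ * B u + (a₃ * M u + a₄ * N u))
    (hu : u ∈ U) (i : Fin n) :
    frameGrad h Q i u * (frameHess h e P i u + K * P u * h i u) +
      frameGrad h P i u * (frameHess h e Q i u + K * Q u * h i u) =
      frameGrad h B i u * ((a₁ * v i u + a₂) * h i u) +
      frameGrad h N i u * ((a₃ * v i u + a₄) * h i u) := by
  have c : ∀ (a : ℝ) {f : (Fin n → ℝ) → ℝ}, ContDiffOn ℝ ∞ f U →
      ContDiffOn ℝ ∞ (fun x => a * f x) U := fun a _ hf => contDiffOn_const.mul hf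
  have d := pd_congr S.isOpen hrel hu i
  rw [pd_add S.isOpen (S.lame.smooth_gradInner hP hQ) ((c K hP).mul hQ) hu,
    pd_mul S.isOpen (c K hP) hQ hu, pd_const_mul S.isOpen hP hu,
    pd_add S.isOpen ((c a₁ S.smooth_A).add (c a₂ S.smooth_B))
      ((c a₃ S.smooth_M).add (c a₄ S.smooth_N)) hu,
    pd_add S.isOpen (c a₁ S.smooth_A) (c a₂ S.smooth_B) hu,
    pd_add S.isOpen (c a₃ S.smooth_M) (c a₄ S.smooth_N) hu,
    pd_const_mul S.isOpen S.smooth_A hu, pd_const_mul S.isOpen S.smooth_B hu,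
    pd_const_mul S.isOpen S.smooth_M hu, pd_const_mul S.isOpen S.smooth_N hu,
    S.lame.pd_gradInner hP hQ HP HQ hu, S.pd_A u hu, S.pd_M u hu,
    S.lame.pd_eq_frameGrad P hu, S.lame.pd_eq_frameGrad Q hu, S.lame.pd_eq_frameGrad B hu,
    S.lame.pd_eq_frameGrad N hu] at d
  linear_combination d

theorem eq_zero_of_dense (hdep : DependsOnAllInvariants U B N) {f : (Fin n → ℝ) → ℝ}
    (hf : ContDiffOn ℝ ∞ f U) (i : Fin n)
    (h0 : ∀ u ∈ U, frameGrad h B i u ≠ 0 ∨ frameGrad h N i u ≠ 0 → f u = 0) :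
    ∀ u ∈ U, f u = 0 := by
  intro u hu
  by_contra hne
  have hev := (hf.continuousOn.continuousAt (S.isOpen.mem_nhds hu)).eventually_ne hne
  obtain ⟨w, hw, hwU, hwd⟩ := mem_closure_iff_nhds.1 (hdep i hu) _ hev
  refine hw (h0 w hwU ?_)
  have hh := S.lame.ne_zero i w hwU
  exact hwd.imp (fun h1 => div_ne_zero h1 hh) fun h1 => div_ne_zero h1 hh

theorem isFlat_of_mainAlternative (hdep : DependsOnAllInvariants U B N)
    (halt : MainAlternative U g K B A N M) : IsFlat U (reciprocalMetric v g B A N M) := by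
  obtain ⟨κ₁, κ₂, κ₃, κ₄, hκ⟩ := halt
  have sE : ∀ (a b : ℝ) {f : (Fin n → ℝ) → ℝ}, ContDiffOn ℝ ∞ f U → ∀ i, ContDiffOn ℝ ∞
      (fun x => frameHess h e f i x + K * f x * h i x - (a * v i x + b) * h i x) U :=
    fun a b f hf i => ((S.lame.smooth_frameHess hf i).add ((contDiffOn_const.mul hf).mul
      (S.lame.smooth i))).sub (((contDiffOn_const.mul (S.smooth_v i)).add contDiffOn_const).mul
      (S.lame.smooth i))
  have rel : ∀ u ∈ U, ∀ i, frameGrad h B i u ≠ 0 ∨ frameGrad h N i u ≠ 0 →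
      frameHess h e B i u + K * B u * h i u - (κ₁ * v i u + κ₂) * h i u = 0 ∧
      frameHess h e N i u + K * N u * h i u - (κ₃ * v i u + κ₄) * h i u = 0 := by
    intro u hu i hi
    have r₁ := S.frameGrad_relation S.smooth_B S.smooth_B S.hess_B S.hess_B
      (a₁ := 2 * κ₁) (a₂ := 2 * κ₂) (a₃ := 0) (a₄ := 0)
      (fun u hu => by linear_combination (hκ u hu).1) hu i
    have r₂ := S.frameGrad_relation S.smooth_N S.smooth_N S.hess_N S.hess_N
      (a₁ := 0) (a₂ := 0) (a₃ := 2 * κ₃) (a₄ := 2 * κ₄)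
      (fun u hu => by linear_combination (hκ u hu).2.1) hu i
    have r₃ := S.frameGrad_relation S.smooth_B S.smooth_N S.hess_B S.hess_N
      (a₁ := κ₃) (a₂ := κ₄) (a₃ := κ₁) (a₄ := κ₂)
      (fun u hu => by linear_combination (hκ u hu).2.2) hu i
    -- With `E_B`, `E_N` the two defects and `ψ` the frame gradients, `r₁`, `r₂`, `r₃` say `ψ_B E_B
    -- = 0`, `ψ_N E_N = 0`, `ψ_N E_B + ψ_B E_N = 0`. A nonzero `ψ_B` or `ψ_N` therefore kills both
    -- defects.
    rcases hi with hi | hi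
    · have z : frameHess h e B i u + K * B u * h i u - (κ₁ * v i u + κ₂) * h i u = 0 := by
        apply mul_left_cancel₀ hi
        linear_combination r₁ / 2
      refine ⟨z, ?_⟩
      apply mul_left_cancel₀ hi
      linear_combination r₃ - frameGrad h N i u * z
    · have z : frameHess h e N i u + K * N u * h i u - (κ₃ * v i u + κ₄) * h i u = 0 := by
        apply mul_left_cancel₀ hi
        linear_combination r₂ / 2
      refine ⟨?_, z⟩
      apply mul_left_cancel₀ hi
      linear_combination r₃ - frameGrad h B i u * z
  have zB : ∀ i, ∀ u ∈ U,
      frameHess h e B i u + K * B u * h i u - (κ₁ * v i u + κ₂) * h i u = 0 := fun i =>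
    S.eq_zero_of_dense hdep (sE κ₁ κ₂ S.smooth_B i) i fun u hu hi => (rel u hu i hi).1
  have zN : ∀ i, ∀ u ∈ U,
      frameHess h e N i u + K * N u * h i u - (κ₃ * v i u + κ₄) * h i u = 0 := fun i =>
    S.eq_zero_of_dense hdep (sE κ₃ κ₄ S.smooth_N i) i fun u hu hi => (rel u hu i hi).2
  intro u hu
  refine S.isLame.riemann_eq_zero hu
    (fun i j k hij hik hjk => S.pd_rot_recipLame hu hij hik hjk) fun i j hij => ?_
  have dB : ∀ i, frameHess h e B i u =
      κ₁ * (A u * recipLame v h B A N M i u + M u * recipLame₂ v h B A N M i u) +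
      (κ₂ - K * B u) * (B u * recipLame v h B A N M i u + N u * recipLame₂ v h B A N M i u) := by
    intro i
    linear_combination zB i u hu + κ₁ * S.velocity_mul_lame_eq hu i +
      (κ₂ - K * B u) * S.lame_eq hu i
  have dN : ∀ i, frameHess h e N i u =
      κ₃ * (A u * recipLame v h B A N M i u + M u * recipLame₂ v h B A N M i u) +
      (κ₄ - K * N u) * (B u * recipLame v h B A N M i u + N u * recipLame₂ v h B A N M i u) := by
    intro i
    linear_combination zN i u hu + κ₃ * S.velocity_mul_lame_eq hu i +
      (κ₄ - K * N u) * S.lame_eq hu i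
  obtain ⟨g₁, g₂, g₃⟩ := hκ u hu
  rw [S.rotCurvature_recipLame hu hij, dB, dB, dN, dN, S.lame_eq hu i, S.lame_eq hu j]
  linear_combination recipLame v h B A N M i u * recipLame v h B A N M j u * g₁ +
    recipLame₂ v h B A N M i u * recipLame₂ v h B A N M j u * g₂ +
    (recipLame v h B A N M i u * recipLame₂ v h B A N M j u +
      recipLame₂ v h B A N M i u * recipLame v h B A N M j u) * g₃

/-- The Hessian of `B` vanishes, so `K b = κ₁ v^i + κ₂` for all `i`, whence `κ₁ = 0`, `κ₂ = K b`.
The gradient relation then reads `K b² = 2 K b²`. -/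
theorem not_isFlat_of_const (hn : 5 ≤ n) (hne : U.Nonempty) (hK : K ≠ 0) {b : ℝ} (hb : b ≠ 0)
    (hB : ∀ u ∈ U, B u = b) : ¬ IsFlat U (reciprocalMetric v g B A N M) := by
  intro hflat
  obtain ⟨u, hu⟩ := hne
  have hψ : ∀ i, ∀ u ∈ U, frameGrad h B i u = 0 := fun i u hu => by
    rw [frameGrad, pd_congr S.isOpen hB hu, pd_const, zero_div]
  have hD : ∀ i, frameHess h e B i u = 0 := fun i => by
    rw [frameHess, pd_congr S.isOpen (hψ i) hu, pd_const, mul_zero, zero_add]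
    exact Finset.sum_eq_zero fun m _ => by rw [hψ m u hu, mul_zero]
  have hG : gradInner g B B u = 0 := by
    rw [S.lame.gradInner_eq B B hu]
    exact Finset.sum_eq_zero fun m _ => by rw [hψ m u hu, mul_zero]
  obtain ⟨κ₁, κ₂, -, -, h1, -, h2, -⟩ := S.exists_affine_of_isFlat hn hflat hu
  have h3 : ∀ i, K * b = κ₁ * v i u + κ₂ := fun i => by
    have := h1 i
    rw [hD, zero_add, hB u hu] at this
    exact mul_right_cancel₀ (S.lame.ne_zero i u hu) this
  let i₀ : Fin n := ⟨0, by omega⟩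
  let i₁ : Fin n := ⟨1, by omega⟩
  have hi : i₀ ≠ i₁ := by simp [i₀, i₁]
  have hκ : κ₁ = 0 := by
    apply mul_right_cancel₀ (sub_ne_zero.2 (S.hyperbolic u hu _ _ hi))
    linear_combination h3 i₁ - h3 i₀
  have h4 := h3 i₀
  rw [hκ, zero_mul, zero_add] at h4
  rw [hG, hκ, hB u hu, ← h4] at h2
  exact mul_ne_zero hK (pow_ne_zero 2 hb) (by linear_combination -h2)

end IsReciprocal

/-! ### Reduction to the general form -/

theorem exists_sign_of_ne_zero (hc : IsConnected U) {f : (Fin n → ℝ) → ℝ}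
    (hf : ContinuousOn f U) (h0 : ∀ u ∈ U, f u ≠ 0) :
    ∃ s : ℝ, s * s = 1 ∧ ∀ u ∈ U, 0 < s * f u := by
  by_cases hp : ∀ u ∈ U, 0 < f u
  · exact ⟨1, by norm_num, fun u hu => by simpa using hp u hu⟩
  push Not at hp
  obtain ⟨a, ha, hfa⟩ := hp
  refine ⟨-1, by norm_num, fun u hu => ?_⟩
  by_contra hneg
  obtain ⟨w, hw, hfw⟩ := hc.isPreconnected.intermediate_value ha hu hf
    (show (0 : ℝ) ∈ Set.Icc (f a) (f u) from ⟨hfa, by linarith⟩)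
  exact h0 w hw hfw

theorem exists_isLame (hU : IsOpen U) (hc : IsConnected U) {g : Fin n → (Fin n → ℝ) → ℝ}
    (hg : ∀ i, ContDiffOn ℝ ∞ (g i) U) (hg0 : ∀ u ∈ U, ∀ i, g i u ≠ 0) :
    ∃ (h : Fin n → (Fin n → ℝ) → ℝ) (e : Fin n → ℝ), IsLame U g h e := by
  -- Connectedness gives each `g_{ii}` a fixed sign `e_i`, so `h_i = √(e_i g_{ii})` is smooth.
  choose e he hpos using fun i =>
    exists_sign_of_ne_zero hc (hg i).continuousOn fun u hu => hg0 u hu i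
  refine ⟨fun i u => Real.sqrt (e i * g i u), e, hU, fun i => ?_, fun i u hu => ?_, fun i => ?_,
    fun u hu i => ?_⟩
  · exact (contDiffOn_const.mul (hg i)).sqrt fun u hu => (hpos i u hu).ne'
  · exact (Real.sqrt_pos.2 (hpos i u hu)).ne'
  · exact left_ne_zero_of_mul (he i ▸ one_ne_zero)
  · rw [Real.sq_sqrt (hpos i u hu).le, ← mul_assoc, he, one_mul]

theorem gradInner_eq_zero_of_const (hU : IsOpen U) (g : Fin n → (Fin n → ℝ) → ℝ)
    {f : (Fin n → ℝ) → ℝ} (q : (Fin n → ℝ) → ℝ) {a : ℝ} (hf : ∀ u ∈ U, f u = a) (hu : u ∈ U) :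
    gradInner g f q u = 0 :=
  Finset.sum_eq_zero fun m _ => by rw [pd_congr hU hf hu, pd_const, mul_zero, zero_mul]

theorem gradInner_comm (g : Fin n → (Fin n → ℝ) → ℝ) (f q : (Fin n → ℝ) → ℝ) :
    gradInner g f q u = gradInner g q f u :=
  Finset.sum_congr rfl fun m _ => by ring

theorem FlatAlternatives.mainAlternative (hU : IsOpen U) {g : Fin n → (Fin n → ℝ) → ℝ}
    {B A N M : (Fin n → ℝ) → ℝ} (h : FlatAlternatives U g B A N M) :
    MainAlternative U g 0 B A N M := by
  rcases h with ⟨κ₁, κ₂, κ₃, -, h⟩ | ⟨κ₁, κ₂, κ₃, -, h⟩ | ⟨κ₁, κ₂, κ₃, κ₄, h⟩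
  -- Read off from `κ₃ (κ₁ B - κ₂ A)`; the mixed relation then holds because `M = κ₁` and `N = κ₂`
  -- make its right side cancel.
  · refine ⟨-(κ₃ * κ₂ / 2), κ₃ * κ₁ / 2, 0, 0, fun u hu => ?_⟩
    obtain ⟨hM, hN, hB⟩ := h u hu
    have hN' : ∀ u ∈ U, N u = κ₂ := fun u hu => (h u hu).2.1
    rw [gradInner_comm g B N, gradInner_eq_zero_of_const hU g _ hN' hu,
      gradInner_eq_zero_of_const hU g _ hN' hu, hB, hM, hN]
    refine ⟨?_, ?_, ?_⟩ <;> ring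
  · refine ⟨0, 0, κ₃ * κ₁ / 2, -(κ₃ * κ₂ / 2), fun u hu => ?_⟩
    obtain ⟨hB, hA, hN⟩ := h u hu
    have hB' : ∀ u ∈ U, B u = κ₁ := fun u hu => (h u hu).1
    rw [gradInner_eq_zero_of_const hU g _ hB' hu, gradInner_eq_zero_of_const hU g _ hB' hu, hN,
      hB, hA]
    refine ⟨?_, ?_, ?_⟩ <;> ring
  · refine ⟨κ₁, κ₂, κ₃, κ₄, fun u hu => ?_⟩
    simpa using h u hu

theorem MainAlternative.flatAlternatives {g : Fin n → (Fin n → ℝ) → ℝ}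
    {B A N M : (Fin n → ℝ) → ℝ} (h : MainAlternative U g 0 B A N M) :
    FlatAlternatives U g B A N M := by
  obtain ⟨κ₁, κ₂, κ₃, κ₄, h⟩ := h
  exact Or.inr (Or.inr ⟨κ₁, κ₂, κ₃, κ₄, fun u hu => by simpa using h u hu⟩)

theorem ConstantCurvatureAlternatives.mainAlternative (hU : IsOpen U)
    {g : Fin n → (Fin n → ℝ) → ℝ} {c : ℝ} {B A N M : (Fin n → ℝ) → ℝ}
    (h : ConstantCurvatureAlternatives U g c B A N M) :
    MainAlternative U g (2 * c) B A N M := by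
  rcases h with ⟨κ₁, κ₃, -, h⟩ | h
  · refine ⟨0, κ₃, 0, 0, fun u hu => ?_⟩
    obtain ⟨-, hN, hB⟩ := h u hu
    have hN' : ∀ u ∈ U, N u = 0 := fun u hu => (h u hu).2.1
    rw [gradInner_comm g B N, gradInner_eq_zero_of_const hU g _ hN' hu,
      gradInner_eq_zero_of_const hU g _ hN' hu, hB, hN]
    refine ⟨?_, ?_, ?_⟩ <;> ring
  · exact h

end Reciprocal

end

/-! ### Assembly of the flat and the constant curvature cases. -/

theorem mainTheorem3 {n : ℕ} (hn : 5 ≤ n)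
    (U : Set (Fin n → ℝ)) (hUo : IsOpen U) (hUc : IsConnected U)
    -- the strictly hyperbolic system `u^i_t = v^i(u) u^i_x`, the metric and the Hamiltonian density
    (v g : Fin n → (Fin n → ℝ) → ℝ) (H : (Fin n → ℝ) → ℝ)
    (hv : ∀ i, ContDiffOn ℝ ∞ (v i) U)
    (hyp : ∀ u ∈ U, ∀ i j, i ≠ j → v i u ≠ v j u)
    (hg : ∀ i, ContDiffOn ℝ ∞ (g i) U) (hg0 : ∀ u ∈ U, ∀ i, g i u ≠ 0)
    (hH : ContDiffOn ℝ ∞ H U)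
    -- the non-trivial reciprocal transformation `dx̂ = B dx + A dt`, `dt̂ = N dx + M dt`
    (B A N M : (Fin n → ℝ) → ℝ)
    (hB : ContDiffOn ℝ ∞ B U) (hA : ContDiffOn ℝ ∞ A U)
    (hN : ContDiffOn ℝ ∞ N U) (hM : ContDiffOn ℝ ∞ M U)
    (hBA : Reciprocal.IsConservationLaw U v B A)
    (hNM : Reciprocal.IsConservationLaw U v N M)
    (hdet : ∀ u ∈ U, B u * M u - A u * N u ≠ 0)
    (hden : ∀ u ∈ U, ∀ i, M u - N u * v i u ≠ 0)
    (hnontriv : ¬ ∃ a b m k : ℝ, ∀ u ∈ U, A u = a ∧ B u = b ∧ M u = m ∧ N u = k) :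
    -- A) flat initial metric
    (Reciprocal.IsFlat U g → Reciprocal.IsHamiltonian U g 0 v H →
      (Reciprocal.IsFlat U (Reciprocal.reciprocalMetric v g B A N M) →
        Reciprocal.FlatAlternatives U g B A N M) ∧
      (Reciprocal.DependsOnAllInvariants U B N → Reciprocal.FlatAlternatives U g B A N M →
        Reciprocal.IsFlat U (Reciprocal.reciprocalMetric v g B A N M))) ∧
    -- B) initial metric of constant curvature `2c`
    (∀ c : ℝ, Reciprocal.HasConstantCurvature U g (2 * c) →
      Reciprocal.IsHamiltonian U g (2 * c) v H →
      (Reciprocal.IsFlat U (Reciprocal.reciprocalMetric v g B A N M) →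
        Reciprocal.ConstantCurvatureAlternatives U g c B A N M) ∧
      (Reciprocal.DependsOnAllInvariants U B N →
        Reciprocal.ConstantCurvatureAlternatives U g c B A N M →
        Reciprocal.IsFlat U (Reciprocal.reciprocalMetric v g B A N M)) ∧
      -- transformations of the single variable `t`, and more generally `B`, `A` constant
      (c ≠ 0 → (∃ κ₁ κ₂ : ℝ, κ₁ ≠ 0 ∧ ∀ u ∈ U, B u = κ₁ ∧ A u = κ₂) →
        ¬ Reciprocal.IsFlat U (Reciprocal.reciprocalMetric v g B A N M))) := by
  have build : ∀ K : ℝ, Reciprocal.HasConstantCurvature U g K →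
      Reciprocal.IsHamiltonian U g K v H →
      ∃ h e, Reciprocal.IsReciprocal U v g h e K B A N M := by
    intro K hK hh
    obtain ⟨h, e, L⟩ := Reciprocal.exists_isLame hUo hUc hg hg0
    have hvh : ∀ u ∈ U, ∀ i j, i ≠ j → Reciprocal.pd j (v i) u * h i u =
        Reciprocal.rot h j i u * h j u * (v j u - v i u) :=
      fun u hu i j hij => L.pd_velocity_mul hK hH hh hv hu hij
    exact ⟨h, e, L, hK, hv, hB, hA, hN, hM, hyp, hvh,
      L.hasDiagonalHessian_of_isConservationLaw hv hyp hvh hB hA hBA,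
      L.hasDiagonalHessian_of_isConservationLaw hv hyp hvh hN hM hNM, hBA, hNM, hdet, hden⟩
  refine ⟨fun hflat hh => ?_, fun c hK hh => ?_⟩
  · obtain ⟨h, e, S⟩ := build 0 hflat.hasConstantCurvature hh
    exact ⟨fun hf => (S.mainAlternative_of_isFlat hn hUc hf).flatAlternatives,
      fun hd ha => S.isFlat_of_mainAlternative hd (ha.mainAlternative hUo)⟩
  · obtain ⟨h, e, S⟩ := build (2 * c) hK hh
    exact ⟨fun hf => Or.inr (S.mainAlternative_of_isFlat hn hUc hf),
      fun hd ha => S.isFlat_of_mainAlternative hd (ha.mainAlternative hUo),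
      fun hc ⟨κ₁, κ₂, hκ, hBA⟩ => S.not_isFlat_of_const hn hUc.nonempty
        (mul_ne_zero two_ne_zero hc) hκ fun u hu => (hBA u hu).1⟩
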